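/- Setting. Let $d\ge 1$, $s>0$, $\Lambda\ge 0$, $\varepsilon\in(0,1/2)$, $0<\sigma_{\min}<\sigma_{\max}<\infty$ and $B,D\in\mathbb R$. Let $\mathcal X\subset\mathbb R^d$ be compact with $\mathrm{diam}(\mathcal X)\le D$ (diameter in the sup norm), let $X$ be a random vector with values in $\mathcal X$ and law $\nu$, and let $Y$ be a real random variable whose conditional density given $X=x$ is a Gaussian mixture with $M$ components, $$f^*(y\mid x)=\sum_{m=1}^M\pi_m(x)\,\phi(y;\mu_m(x),\sigma_m^2(x)),$$ where $\phi(\cdot;\mu,\sigma^2)$ is the density of $N(\mu,\sigma^2)$. Assume that for all $x,x'\in\mathcal X$ and all $m$: $\sum_m\pi_m(x)=1$, $\pi_m(x)\in[\varepsilon,1-\varepsilon]$, $\sigma_m(x)\in[\sigma_{\min},\sigma_{\max}]$, $|\mu_m(x)|\le B$, and $|g(x)-g(x')|\le\Lambda\|x-x'\|_\infty^s$ for each $g\in\{\pi_m,\mu_m,\sigma_m\}$. Model class. For integers $n\ge1$, $K\ge M$, a depth bound $L\in\mathbb N\cup\{\infty\}$ and a weight bound $W\in[0,\infty]$, let $\mathcal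 F_{n,K}$ be the class of all $K$-component mixtures $f(y\mid x)=\sum_{k=1}^K\tilde\pi_k(x)\phi(y;\tilde\mu_k(x),\tilde\sigma_k^2(x))$ such that each of the functions $\tilde\pi_k,\tilde\mu_k,\tilde\sigma_k$ is implemented by a ReLU network (with affine output layer) of width at most $n$, with at most $L$ hidden layers and with all weights and biases at most $W$ in absolute value, and such that for all $x\in\mathcal X$: $\tilde\pi_k(x)\ge0$, $\sum_k\tilde\pi_k(x)=1$, $|\tilde\mu_k(x)|\le B$, $\tilde\sigma_k(x)\in[\sigma_{\min},\sigma_{\max}]$. Let $C(n,K,d)\in[0,\infty]$ be the least $C$ such that the covering numbers of $\mathcal F_{n,K}$ for the sup norm of the functions $(x,y)\mapsto f(y\mid x)$ on $\mathcal X\times\mathbb R$ satisfy $\log N(\eta,\mathcal F_{n,K},\|\cdot\|_\infty)\le C\log(1/\eta)$ for all $0<\eta\le 1/2$. Estimator and loss. Given i.i.d. copies $(X_i,Y_i)_{i=1}^N$ of $(X,Y)$, $N\ge1$, an empirical risk minimizer is any $\hat f_{n,K}\in\mathcal F_{n,K}$ that minimizes $-\frac1N\sum_{i=1}^N\log f(Y_i\mid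 X_i)$ over $f\in\mathcal F_{n,K}$. Put $\mathrm{KL}(f^*\|f)=\mathbb E_{X\sim\nu}\,\mathrm{KL}\big(f^*(\cdot\mid X)\,\|\,f(\cdot\mid X)\big)$. Theorem. There are a depth $L_0$ depending only on $d$ and $s$, constants $C_2,C_3>0$ depending only on $d,s,\Lambda,\varepsilon,\sigma_{\min},\sigma_{\max},B,D$, and a constant $W_0>0$ depending only on these and on $\mathcal X$, such that for all $M$, $f^*$ and $\nu$ as above, all $n\ge1$, $K\ge M$, $N\ge1$, all $L\in[L_0,\infty]$ and $W\in[W_0n,\infty]$, and all $\delta\in(0,1)$: with probability at least $1-\delta$, every empirical risk minimizer $\hat f_{n,K}$ over $\mathcal F_{n,K}$ satisfies $$\mathrm{KL}(f^*\|\hat f_{n,K})\le C_2\,K\,n^{-2s/d}+C_3\sqrt{\frac{C(n,K,d)+\log(1/\delta)}{N}}.$$ -/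

import Mathlib

open MeasureTheory ProbabilityTheory InformationTheory Set
open scoped NNReal ENNReal Matrix

noncomputable section

namespace MDN

/-- `HiddenLayer d n W l m h`: the map `h : ℝ^d → ℝ^m` is the output of the last of `l` successive
ReLU layers, each with at most `n` neurons and with all weights and biases bounded by `W` in
absolute value (`W = ∞` means no restriction). For `l = 0` this is the input itself, whose
dimension does not count for the width. -/
inductive HiddenLayer (d n : ℕ) (W : ℝ≥0∞) :
    (l m : ℕ) → ((Fin d → ℝ) → (Fin m → ℝ)) → Prop
  | input : HiddenLayer d n W 0 d (fun x => x)
  | layer {l m m' : ℕ} {h : (Fin d → ℝ) → (Fin m → ℝ)}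
      (A : Matrix (Fin m') (Fin m) ℝ) (b : Fin m' → ℝ)
      (hh : HiddenLayer d n W l m h) (hm' : m' ≤ n)
      (hA : ∀ i j, ‖A i j‖ₑ ≤ W) (hb : ∀ i, ‖b i‖ₑ ≤ W) :
      HiddenLayer d n W (l + 1) m' (fun x i => max ((A *ᵥ h x) i + b i) 0)

/-- Scalar functions on `ℝ^d` implemented by a ReLU network of width at most `n`, with at most `L`
hidden layers (`L = ⊤`: any number) and with weights and biases bounded by `W` (`W = ∞`: no bound).
The output layer is affine. -/
def IsReLUNet (d n : ℕ) (L : ℕ∞) (W : ℝ≥0∞) (g : (Fin d → ℝ) → ℝ) : Prop :=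
  ∃ (l m : ℕ) (h : (Fin d → ℝ) → (Fin m → ℝ)) (a : Fin m → ℝ) (b : ℝ),
    (l : ℕ∞) ≤ L ∧ HiddenLayer d n W l m h ∧ (∀ i, ‖a i‖ₑ ≤ W) ∧ ‖b‖ₑ ≤ W ∧
    ∀ x, g x = a ⬝ᵥ h x + b

/-- Parameter functions `(π_k, μ_k, σ_k)` of a conditional Gaussian mixture with `K` components. -/
structure MixParams (d K : ℕ) where
  weight : Fin K → (Fin d → ℝ) → ℝ
  mean : Fin K → (Fin d → ℝ) → ℝ
  std : Fin K → (Fin d → ℝ) → ℝ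

variable {d K : ℕ}

/-- The conditional density `∑ k, π_k(x) φ(y; μ_k(x), σ_k(x)^2)`. -/
def MixParams.density (p : MixParams d K) (x : Fin d → ℝ) (y : ℝ) : ℝ :=
  ∑ k, p.weight k x * gaussianPDFReal (p.mean k x) (Real.toNNReal (p.std k x ^ 2)) y

/-- The conditional law of `Y` given `X = x`, i.e. the measure with density `p.density x`. -/
def MixParams.condLaw (p : MixParams d K) (x : Fin d → ℝ) : Measure ℝ :=
  volume.withDensity (fun y => ENNReal.ofReal (p.density x y))

/-- The joint law of `(X, Y)` when `X` has law `ν` and `Y` has conditional density `p`. -/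
def MixParams.jointLaw (p : MixParams d K) (ν : Measure (Fin d → ℝ)) :
    Measure ((Fin d → ℝ) × ℝ) :=
  (ν.prod volume).withDensity (fun z => ENNReal.ofReal (p.density z.1 z.2))

/-- The assumptions on the true model: a Gaussian mixture on `X` whose parameter functions are
`s`-Hölder (for the sup norm of `ℝ^d`) with constant `Λ`, bounded and non-degenerate. -/
structure IsTrueModel (X : Set (Fin d → ℝ)) (s Λ : ℝ≥0) (ε σmin σmax B : ℝ)
    (p : MixParams d K) : Prop where
  weight_sum : ∀ x ∈ X, ∑ k, p.weight k x = 1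
  weight_mem : ∀ k, ∀ x ∈ X, p.weight k x ∈ Icc ε (1 - ε)
  std_mem : ∀ k, ∀ x ∈ X, p.std k x ∈ Icc σmin σmax
  mean_bdd : ∀ k, ∀ x ∈ X, |p.mean k x| ≤ B
  weight_holder : ∀ k, HolderOnWith Λ s (p.weight k) X
  mean_holder : ∀ k, HolderOnWith Λ s (p.mean k) X
  std_holder : ∀ k, HolderOnWith Λ s (p.std k) X

/-- The model class `F_{n,K}`: mixtures with `K` components on `X`, with standard deviations in
`[σmin, σmax]` and means in `[-B, B]`, each of whose parameter functions is a ReLU network of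
width at most `n`. -/
def modelClass (X : Set (Fin d → ℝ)) (σmin σmax B : ℝ) (n K : ℕ) (L : ℕ∞) (W : ℝ≥0∞) :
    Set (MixParams d K) :=
  {p | (∀ k, IsReLUNet d n L W (p.weight k)) ∧ (∀ k, IsReLUNet d n L W (p.mean k)) ∧
      (∀ k, IsReLUNet d n L W (p.std k)) ∧
      ∀ x ∈ X, (∑ k, p.weight k x = 1) ∧
        ∀ k, 0 ≤ p.weight k x ∧ |p.mean k x| ≤ B ∧ p.std k x ∈ Icc σmin σmax}

/-- `F` has a finite `η`-cover with at most `c` elements for the sup norm on `X × ℝ` of the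
conditional densities `(x, y) ↦ f(y | x)`. -/
def HasCover (X : Set (Fin d → ℝ)) (F : Set (MixParams d K)) (η c : ℝ) : Prop :=
  ∃ t : Finset ((Fin d → ℝ) → ℝ → ℝ), (t.card : ℝ) ≤ c ∧
    ∀ p ∈ F, ∃ g ∈ t, ∀ x ∈ X, ∀ y, |p.density x y - g x y| ≤ η

/-- The complexity of `F`: the least `C ≥ 0` such that the sup-norm covering numbers satisfy
`log N(η, F, ‖·‖_∞) ≤ C log (1/η)` for all `0 < η ≤ 1/2` (`∞` if there is none). -/
def complexity (X : Set (Fin d → ℝ)) (F : Set (MixParams d K)) : ℝ≥0∞ :=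
  ⨅ (C : ℝ≥0) (_ : ∀ η ∈ Ioc (0 : ℝ) (1 / 2), HasCover X F η ((1 / η) ^ (C : ℝ))), (C : ℝ≥0∞)

/-- The empirical negative log-likelihood of the sample `z`. -/
def nll {N : ℕ} (z : Fin N → (Fin d → ℝ) × ℝ) (p : MixParams d K) : ℝ :=
  (1 / (N : ℝ)) * ∑ i, -Real.log (p.density (z i).1 (z i).2)

/-- `p` is an empirical risk minimizer over `F` for the sample `z`. -/
def IsERM (F : Set (MixParams d K)) {N : ℕ} (z : Fin N → (Fin d → ℝ) × ℝ)
    (p : MixParams d K) : Prop :=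
  p ∈ F ∧ ∀ q ∈ F, nll z p ≤ nll z q

/-- The Kullback-Leibler divergence between conditional densities,
`E_{X ∼ ν} KL(p(· | X) ‖ q(· | X))`. -/
def condKL {K' : ℕ} (ν : Measure (Fin d → ℝ)) (p : MixParams d K) (q : MixParams d K') : ℝ≥0∞ :=
  ∫⁻ x, klDiv (p.condLaw x) (q.condLaw x) ∂ν

end MDN

end

/-! Let `P` be the joint law and call "deviation" the empirical mean minus the `P`-mean. The
conditional divergence is the `P`-mean of `log f* - log f`, so minimality of the empirical risk
gives, for every `f` in the class, that KL(f*‖f̂) is at most KL(f*‖f) plus the deviation of `log f̂`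
minus that of `log f`. This leaves an approximation error and a uniform deviation.

Approximation. The Kuhn hat functions of a grid with q cells per direction sum to one, because the
hat at `j` is the length of the set of `t ∈ [0,1)` for which the scaled point shifted by `t(1,…,1)`
rounds down to `j` (`hat_eq_volume`). A hat needs two maxima over `d` coordinates, hence depth `d +
2`, and all hats together need a multiple of q^d neurons. All parameters of f* are interpolated with
the same hats from values at points of X; these are convex combinations, so every constraint
survives, with error η of order q^(-s), that is n^(-s/d). By the log-sum inequality the divergence
splits over components, first-order terms cancel, and each component costs O(η²)
(`klAt_le_of_close`).

Deviation. With V = a(1 + y²) all densities lie in [exp(-V), exp V], and exp(λV) is integrable for a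
small λ only. The Lipschitz constant exp V of the logarithm may thus have no moments, but min(τ^p
exp V, 2V) ≤ 2τV exp(V/p), which for large p has second moment O(τ²). Covering the densities at
scale 2^(-pk) therefore makes log-densities 2^(-k)-close in the sense Bernstein's inequality needs,
and multiplies the entropy only by p. Chaining from `f`, stopped at 2^(-m) of the order of the
target rate, loses no logarithm (`exists_uniform_deviation_event`).

The divergence is uniformly bounded over the class, so degenerate regimes (small `n`, infinite
complexity, rate above one) are absorbed in the constants. The complexity is at least one
(`one_le_complexity_modelClass`), which pays for the union bound over levels. -/

namespace MDN

/-! ### Building blocks for ReLU networks -/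

/-- `HiddenLayer` with the neurons of the last layer indexed by an arbitrary finite type. -/
def IsHidden (d n : ℕ) (W : ℝ≥0∞) (l : ℕ) {ι : Type} (H : (Fin d → ℝ) → ι → ℝ) : Prop :=
  ∃ (m : ℕ) (e : Fin m ≃ ι), HiddenLayer d n W l m (fun x i => H x (e i))

theorem isHidden_input (d n : ℕ) (W : ℝ≥0∞) :
    IsHidden d n W 0 (fun x : Fin d → ℝ => x) :=
  ⟨d, Equiv.refl _, HiddenLayer.input⟩

theorem enorm_le_of_abs_le {r w : ℝ} {W : ℝ≥0∞} (h : |r| ≤ w) (hW : ENNReal.ofReal w ≤ W) :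
    ‖r‖ₑ ≤ W := by
  rw [← ofReal_norm, Real.norm_eq_abs]
  exact (ENNReal.ofReal_le_ofReal h).trans hW

theorem IsHidden.layer {d n : ℕ} {W : ℝ≥0∞} {l : ℕ} {ι κ : Type} [Fintype ι] [Fintype κ]
    {H : (Fin d → ℝ) → ι → ℝ} (hH : IsHidden d n W l H) {w : ℝ} (hW : ENNReal.ofReal w ≤ W)
    (hκ : Fintype.card κ ≤ n) (A : κ → ι → ℝ) (b : κ → ℝ)
    (hA : ∀ k i, |A k i| ≤ w) (hb : ∀ k, |b k| ≤ w) :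
    IsHidden d n W (l + 1) (fun x k => max (A k ⬝ᵥ H x + b k) 0) := by
  obtain ⟨m, e, hm⟩ := hH
  let e' := (Fintype.equivFin κ).symm
  refine ⟨Fintype.card κ, e', ?_⟩
  have := HiddenLayer.layer (Matrix.of fun i j => A (e' i) (e j)) (fun i => b (e' i)) hm hκ
    (fun i j => enorm_le_of_abs_le (hA _ _) hW) (fun i => enorm_le_of_abs_le (hb _) hW)
  convert this using 5 with x i
  simp only [dotProduct, Matrix.mulVec, Matrix.of_apply]
  exact (Equiv.sum_comp e (fun i' => A (e' i) i' * H x i')).symm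

theorem IsHidden.isReLUNet {d n : ℕ} {W : ℝ≥0∞} {l : ℕ} {L : ℕ∞} {ι : Type} [Fintype ι]
    {H : (Fin d → ℝ) → ι → ℝ} (hH : IsHidden d n W l H) {w : ℝ} (hW : ENNReal.ofReal w ≤ W)
    (hL : (l : ℕ∞) ≤ L) (a : ι → ℝ) (ha : ∀ i, |a i| ≤ w) :
    IsReLUNet d n L W (fun x => a ⬝ᵥ H x) := by
  obtain ⟨m, e, hm⟩ := hH
  refine ⟨l, m, _, fun i => a (e i), 0, hL, hm, fun i => enorm_le_of_abs_le (ha _) hW,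
    by simp, fun x => ?_⟩
  simp only [dotProduct, add_zero]
  exact (Equiv.sum_comp e (fun i' => a i' * H x i')).symm

theorem isReLUNet_const {d n : ℕ} {W : ℝ≥0∞} {L : ℕ∞} {w : ℝ} (hW : ENNReal.ofReal w ≤ W)
    (c : ℝ) (hc : |c| ≤ w) : IsReLUNet d n L W (fun _ => c) :=
  ⟨0, d, _, 0, c, by simp, HiddenLayer.input, by simp, enorm_le_of_abs_le hc hW, by simp⟩

theorem HiddenLayer.continuous {d n : ℕ} {W : ℝ≥0∞} {l m : ℕ} {h : (Fin d → ℝ) → (Fin m → ℝ)}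
    (hh : HiddenLayer d n W l m h) : Continuous h := by
  induction hh with
  | input => exact continuous_id
  | layer A b _ _ _ _ ih =>
    refine continuous_pi fun i => ?_
    have h1 : Continuous fun x => A *ᵥ (_ : (Fin d → ℝ) → _) x :=
      Continuous.matrix_mulVec continuous_const ih
    exact (((continuous_apply i).comp h1).add continuous_const).max continuous_const

theorem IsReLUNet.continuous {d n : ℕ} {L : ℕ∞} {W : ℝ≥0∞} {g : (Fin d → ℝ) → ℝ}
    (hg : IsReLUNet d n L W g) : Continuous g := by
  obtain ⟨l, m, h, a, b, -, hh, -, -, hgx⟩ := hg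
  rw [funext hgx]
  exact (continuous_const.dotProduct hh.continuous).add continuous_const

/-! ### Hat functions of the Kuhn triangulation as ReLU networks -/

/-- The maximum of `0` and the first `k` entries of `a`. -/
def prefixMax {d : ℕ} (a : Fin d → ℝ) : ℕ → ℝ
  | 0 => 0
  | k + 1 => max (prefixMax a k) (if h : k < d then a ⟨k, h⟩ else 0)

theorem prefixMax_le_iff {d : ℕ} (a : Fin d → ℝ) (k : ℕ) (t : ℝ) :
    prefixMax a k ≤ t ↔ 0 ≤ t ∧ ∀ i : Fin d, i.1 < k → a i ≤ t := by
  induction k with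
  | zero => simp [prefixMax]
  | succ k ih =>
    rw [prefixMax, max_le_iff, ih]
    constructor
    · rintro ⟨⟨h0, h1⟩, h2⟩
      refine ⟨h0, fun i hi => ?_⟩
      rcases Nat.lt_succ_iff_lt_or_eq.mp hi with h | h
      · exact h1 i h
      · have : k < d := h ▸ i.2
        rw [dif_pos this] at h2
        rwa [show i = ⟨k, this⟩ from Fin.ext h]
    · rintro ⟨h0, h1⟩
      refine ⟨⟨h0, fun i hi => h1 i (by omega)⟩, ?_⟩
      split_ifs with h
      · exact h1 _ (by simp)
      · exact h0

theorem prefixMax_nonneg {d : ℕ} (a : Fin d → ℝ) (k : ℕ) : 0 ≤ prefixMax a k :=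
  ((prefixMax_le_iff a k _).mp le_rfl).1

/-- Distance of `ρ * x i` beyond `j i`, in the direction given by the sign. -/
def excess {d : ℕ} (ρ : ℝ) (j : Fin d → ℝ) (b : Bool) (x : Fin d → ℝ) (i : Fin d) : ℝ :=
  max ((bif b then 1 else -1) * (ρ * x i - j i)) 0

/-- The hat function of the Kuhn triangulation of scale `1 / ρ` around the grid point `j / ρ`. -/
def hat {d : ℕ} (ρ : ℝ) (j : Fin d → ℝ) (x : Fin d → ℝ) : ℝ :=
  max (1 - prefixMax (excess ρ j true x) d - prefixMax (excess ρ j false x) d) 0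

/-- The neurons that carry the excesses and their first `k` running maxima. -/
def maxState {d : ℕ} {J : Type} (ρ : ℝ) (pos : J → Fin d → ℝ) (k : ℕ) (x : Fin d → ℝ) :
    J × Bool × Option (Option (Fin d)) → ℝ
  | (j, b, some (some i)) => excess ρ (pos j) b x i
  | (j, b, some none) => prefixMax (excess ρ (pos j) b x) (k - 1)
  | (j, b, none) =>
      prefixMax (excess ρ (pos j) b x) k - prefixMax (excess ρ (pos j) b x) (k - 1)

theorem abs_single_le {ι : Type} [DecidableEq ι] (i i' : ι) (c : ℝ) :
    |(Pi.single i c : ι → ℝ) i'| ≤ |c| := by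
  rw [Pi.single_apply]; split_ifs <;> simp

/-- Since `max P u = P + max (u - P) 0`, a running maximum can be stored as two nonnegative neurons,
its previous value and its last increment. Each layer adds these two and computes the next increment
with one ReLU; the excesses, being nonnegative, pass through unchanged. Each of the two signs thus
uses `d + 2` neurons per grid point. The weights of a row are bounded crudely by a sum of three unit
entries, whence `3 ≤ w`. -/
theorem isHidden_maxState {d n : ℕ} {W : ℝ≥0∞} {J : Type} [Fintype J] {w ρ : ℝ}
    (hW : ENNReal.ofReal w ≤ W) (h3 : 3 ≤ w) (hρ : |ρ| ≤ w) (pos : J → Fin d → ℝ)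
    (hpos : ∀ j i, |pos j i| ≤ w) (hn : Fintype.card J * (2 * (d + 2)) ≤ n) (k : ℕ) (hk : k ≤ d) :
    IsHidden d n W (k + 1) (maxState ρ pos k) := by
  classical
  have hcard : Fintype.card (J × Bool × Option (Option (Fin d))) ≤ n := by simpa using hn
  induction k with
  | zero =>
    convert (isHidden_input d n W).layer hW hcard
      (fun κ => match κ with
        | (_, b, some (some i)) => Pi.single i ((bif b then 1 else -1) * ρ)
        | _ => 0)
      (fun κ => match κ with
        | (j, b, some (some i)) => (bif b then 1 else -1) * (-pos j i)
        | _ => 0) ?_ ?_ using 1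
    · funext x κ
      obtain ⟨j, b, _ | _ | i⟩ := κ
      · simp [maxState, prefixMax]
      · simp [maxState, prefixMax]
      · simp only [maxState, excess, single_dotProduct]
        ring_nf
    · rintro ⟨j, b, _ | _ | i⟩ i'
      · simp; linarith
      · simp; linarith
      · refine (abs_single_le _ _ _).trans ?_
        cases b <;> simpa using hρ
    · rintro ⟨j, b, _ | _ | i⟩
      · simp; linarith
      · simp; linarith
      · have := hpos j i
        cases b <;> simpa using this
  | succ k ih =>
    have hkd : k < d := hk
    convert (ih (by omega)).layer hW hcard
      (fun κ => match κ with
        | (j, b, some (some i)) => Pi.single (j, b, some (some i)) 1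
        | (j, b, some none) => Pi.single (j, b, some none) 1 + Pi.single (j, b, none) 1
        | (j, b, none) => Pi.single (j, b, some (some ⟨k, hkd⟩)) 1
            + Pi.single (j, b, some none) (-1) + Pi.single (j, b, none) (-1))
      (fun _ => 0) ?_ ?_ using 1
    · funext x κ
      obtain ⟨j, b, _ | _ | i⟩ := κ
      · simp only [maxState, add_dotProduct, single_dotProduct, prefixMax, dif_pos hkd,
          Nat.add_sub_cancel]
        generalize prefixMax (excess ρ (pos j) b x) k = P
        have : ∀ u : ℝ, max P u - P = max (u - P) 0 := fun u => by
          rw [← max_sub_sub_right, sub_self, max_comm]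
        rw [this]
        ring_nf
      · simp only [maxState, add_dotProduct, single_dotProduct, Nat.add_sub_cancel]
        rw [max_eq_left]
        · ring
        · linarith [prefixMax_nonneg (excess ρ (pos j) b x) k]
      · simp only [maxState, single_dotProduct, one_mul, add_zero]
        rw [max_eq_left]
        exact le_max_right _ _
    · rintro ⟨j, b, _ | _ | i⟩ i'
      · refine (abs_add_three _ _ _).trans ?_
        have h1 := abs_single_le (j, b, some (some (⟨k, hkd⟩ : Fin d))) i' 1
        have h2 := abs_single_le (j, b, (some none : Option (Option (Fin d)))) i' (-1)
        have h3 := abs_single_le (j, b, (none : Option (Option (Fin d)))) i' (-1)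
        simp only [abs_neg, abs_one] at h1 h2 h3
        linarith
      · refine (abs_add_le _ _).trans ?_
        have h2 := abs_single_le (j, b, (some none : Option (Option (Fin d)))) i' 1
        have h3 := abs_single_le (j, b, (none : Option (Option (Fin d)))) i' 1
        simp only [abs_one] at h2 h3
        linarith
      · refine (abs_single_le _ _ _).trans ?_
        simp; linarith
    · intro _
      simp; linarith

theorem isHidden_hat {d n : ℕ} {W : ℝ≥0∞} {J : Type} [Fintype J] {w ρ : ℝ}
    (hW : ENNReal.ofReal w ≤ W) (h3 : 3 ≤ w) (hρ : |ρ| ≤ w) (pos : J → Fin d → ℝ)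
    (hpos : ∀ j i, |pos j i| ≤ w) (hn : Fintype.card J * (2 * (d + 2)) ≤ n) :
    IsHidden d n W (d + 2) (fun x j => hat ρ (pos j) x) := by
  classical
  convert (isHidden_maxState hW h3 hρ pos hpos hn d le_rfl).layer hW (κ := J)
    ((Nat.le_mul_of_pos_right _ (by omega)).trans hn)
    (fun j => (Pi.single (j, true, some none) (-1) + Pi.single (j, true, none) (-1)) +
      (Pi.single (j, false, some none) (-1) + Pi.single (j, false, none) (-1)))
    (fun _ => 1) ?_ ?_ using 1
  · funext x j
    simp only [maxState, hat, add_dotProduct, single_dotProduct]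
    ring_nf
  · intro j i'
    rw [Pi.add_apply, Pi.add_apply, Pi.add_apply]
    simp only [Pi.single_apply]
    obtain ⟨j', b, _ | _ | i⟩ := i'
    all_goals
      cases b <;> simp <;> (try split_ifs) <;> (try simp) <;> linarith
  · intro _
    simp; linarith

theorem hat_nonneg {d : ℕ} (ρ : ℝ) (j x : Fin d → ℝ) : 0 ≤ hat ρ j x := le_max_right _ _

theorem abs_sub_lt_one_of_hat_ne_zero {d : ℕ} {ρ : ℝ} {j x : Fin d → ℝ} (h : hat ρ j x ≠ 0)
    (i : Fin d) : |ρ * x i - j i| < 1 := by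
  have hpos : 0 < 1 - prefixMax (excess ρ j true x) d - prefixMax (excess ρ j false x) d := by
    by_contra hc
    exact h (max_eq_right (not_lt.mp hc))
  have h1 := ((prefixMax_le_iff (excess ρ j true x) d _).mp le_rfl).2 i i.2
  have h2 := ((prefixMax_le_iff (excess ρ j false x) d _).mp le_rfl).2 i i.2
  have n1 := prefixMax_nonneg (excess ρ j true x) d
  have n2 := prefixMax_nonneg (excess ρ j false x) d
  have h3 := (max_le_iff.mp h1).1
  have h4 := (max_le_iff.mp h2).1
  simp only [cond_true, cond_false] at h3 h4
  rw [abs_lt]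
  constructor <;> linarith

/-- The hat function is the length of the set of shifts that round to the grid point. -/
theorem hat_eq_volume {d : ℕ} (ρ : ℝ) (j : Fin d → ℤ) (x : Fin d → ℝ) :
    ENNReal.ofReal (hat ρ (fun i => j i) x) =
      volume (Ico (0 : ℝ) 1 ∩ {t | (fun i => ⌊ρ * x i + t⌋) = j}) := by
  have : Ico (0 : ℝ) 1 ∩ {t | (fun i => ⌊ρ * x i + t⌋) = j} =
      Ico (prefixMax (excess ρ (fun i => j i) false x) d)
        (1 - prefixMax (excess ρ (fun i => j i) true x) d) := by
    ext t
    have hA : t < 1 - prefixMax (excess ρ (fun i => (j i : ℝ)) true x) d ↔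
        t < 1 ∧ ∀ i : Fin d, ρ * x i + t < j i + 1 := by
      constructor
      · intro ht
        have := (prefixMax_le_iff (excess ρ (fun i => (j i : ℝ)) true x) d _).mp le_rfl
        refine ⟨by linarith [this.1], fun i => ?_⟩
        have h3 := (max_le_iff.mp (this.2 i i.2)).1
        simp only [cond_true] at h3
        linarith
      · rintro ⟨h0, h1⟩
        by_contra hc
        rw [not_lt] at hc
        -- `prefixMax_le_iff` speaks of non-strict inequalities only. Finitely many strict ones
        -- leave room for a larger `t'`, limited by the tightest coordinate.
        have hlt : ∃ t', t < t' ∧ t' ≤ 1 ∧ ∀ i : Fin d, ρ * x i + t' ≤ j i + 1 := by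
          rcases isEmpty_or_nonempty (Fin d) with he | he
          · exact ⟨1, h0, le_rfl, fun i => he.elim i⟩
          · obtain ⟨i0, hi0⟩ := Finite.exists_min (fun i : Fin d => (j i : ℝ) + 1 - ρ * x i)
            refine ⟨min 1 (j i0 + 1 - ρ * x i0), lt_min h0 (by linarith [h1 i0]),
              min_le_left _ _, fun i => ?_⟩
            have := min_le_right 1 ((j i0 : ℝ) + 1 - ρ * x i0)
            linarith [hi0 i]
        obtain ⟨t', ht, ht1, hti⟩ := hlt
        have : prefixMax (excess ρ (fun i => (j i : ℝ)) true x) d ≤ 1 - t' := by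
          rw [prefixMax_le_iff]
          refine ⟨by linarith, fun i _ => max_le ?_ (by linarith)⟩
          simp only [cond_true]
          linarith [hti i]
        linarith
    have hB : prefixMax (excess ρ (fun i => (j i : ℝ)) false x) d ≤ t ↔
        0 ≤ t ∧ ∀ i : Fin d, (j i : ℝ) ≤ ρ * x i + t := by
      rw [prefixMax_le_iff]
      refine and_congr_right fun h0 => forall_congr' fun i => ?_
      simp only [Fin.is_lt, forall_const, excess, max_le_iff, cond_false]
      constructor
      · intro h; linarith [h.1]
      · intro h; exact ⟨by linarith, h0⟩
    rw [mem_Ico, hA, hB]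
    simp only [mem_inter_iff, mem_Ico, mem_ofPred_eq, funext_iff, Int.floor_eq_iff]
    constructor
    · rintro ⟨⟨h0, h1⟩, h2⟩
      exact ⟨⟨h0, fun i => (h2 i).1⟩, h1, fun i => (h2 i).2⟩
    · rintro ⟨⟨h0, h1⟩, h2, h3⟩
      exact ⟨⟨h0, h2⟩, fun i => ⟨h1 i, h3 i⟩⟩
  rw [this, Real.volume_Ico, hat]
  rcases le_total 0 (1 - prefixMax (excess ρ (fun i => (j i : ℝ)) true x) d
    - prefixMax (excess ρ (fun i => (j i : ℝ)) false x) d) with h | h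
  · rw [max_eq_left h]
  · rw [max_eq_right h, ENNReal.ofReal_zero, ENNReal.ofReal_of_nonpos h]

/-- Each shift `t ∈ [0,1)` rounds the scaled point to exactly one grid point, at distance less than
1 in every coordinate. The sets measured by the hats therefore partition `[0,1)`. -/
theorem sum_hat_eq_one {d : ℕ} (ρ : ℝ) (J : Finset (Fin d → ℤ)) (x : Fin d → ℝ)
    (hJ : ∀ j : Fin d → ℤ, (∀ i, |ρ * x i - j i| < 1) → j ∈ J) :
    ∑ j ∈ J, hat ρ (fun i => j i) x = 1 := by
  have hmeas : ∀ j : Fin d → ℤ,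
      MeasurableSet (Ico (0 : ℝ) 1 ∩ {t | (fun i => ⌊ρ * x i + t⌋) = j}) := by
    intro j
    refine measurableSet_Ico.inter ?_
    have : Measurable fun t : ℝ => fun i : Fin d => ⌊ρ * x i + t⌋ :=
      measurable_pi_lambda _ fun i => Int.measurable_floor.comp (measurable_const_add _)
    exact this (measurableSet_singleton j)
  have h1 : ∑ j ∈ J, ENNReal.ofReal (hat ρ (fun i => j i) x) = 1 := by
    simp_rw [hat_eq_volume]
    rw [← measure_biUnion_finset _ fun j _ => hmeas j]
    · have : (⋃ j ∈ J, Ico (0 : ℝ) 1 ∩ {t | (fun i => ⌊ρ * x i + t⌋) = j}) = Ico 0 1 := by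
        refine Subset.antisymm (iUnion₂_subset fun j _ => inter_subset_left) fun t ht => ?_
        refine mem_iUnion₂.mpr ⟨fun i => ⌊ρ * x i + t⌋, hJ _ fun i => ?_, ht, rfl⟩
        have h1 := Int.floor_le (ρ * x i + t)
        have h2 := Int.lt_floor_add_one (ρ * x i + t)
        rw [abs_lt]
        constructor <;> linarith [ht.1, ht.2]
      rw [this]
      simp
    · intro j _ j' _ hne
      refine Set.disjoint_left.mpr fun t ht ht' => hne ?_
      exact ht.2.symm.trans ht'.2
  rw [← ENNReal.ofReal_sum_of_nonneg fun j _ => hat_nonneg _ _ _] at h1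
  simpa using h1

/-- A partition of unity on `X` by functions supported near points of `X`, all of whose linear
combinations are ReLU networks. -/
theorem exists_relu_partition {d : ℕ} {X : Set (Fin d → ℝ)} (hX : Bornology.IsBounded X)
    {x₀ : Fin d → ℝ} (hx₀ : x₀ ∈ X) {D : ℝ} (hD : Metric.diam X ≤ D) {q : ℕ} (hq : 1 ≤ q) :
    ∃ (J : Type) (_ : Fintype J) (φ : J → (Fin d → ℝ) → ℝ) (ξ : J → Fin d → ℝ),
      (∀ j, ξ j ∈ X) ∧ (∀ j x, 0 ≤ φ j x) ∧ (∀ x ∈ X, ∑ j, φ j x = 1) ∧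
      (∀ x ∈ X, ∀ j, φ j x ≠ 0 → dist x (ξ j) ≤ 2 * ((D + 1) / q)) ∧
      ∀ (n : ℕ) (W : ℝ≥0∞) (L : ℕ∞) (w : ℝ), ENNReal.ofReal w ≤ W → 3 ≤ w →
        (‖x₀‖ + 1) * q + 2 ≤ w → (4 * q) ^ d * (2 * (d + 2)) ≤ n → ((d + 2 : ℕ) : ℕ∞) ≤ L →
        ∀ c : J → ℝ, (∀ j, |c j| ≤ w) → IsReLUNet d n L W (fun x => ∑ j, c j * φ j x) := by
  classical
  have hD0 : 0 ≤ D := Metric.diam_nonneg.trans hD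
  have hq0 : (1 : ℝ) ≤ q := by exact_mod_cast hq
  -- `D + 1` keeps the denominator positive when `X` is a single point, and still gives `ρ * D ≤ q`:
  -- scaled, `X` extends at most `q` from `x₀` in each coordinate.
  set ρ : ℝ := q / (D + 1) with hρ
  have hρ0 : 0 < ρ := by positivity
  have hρq : ρ ≤ q := div_le_self (by linarith) (by linarith)
  have hρD : ρ * D ≤ q := by
    rw [hρ, div_mul_eq_mul_div, div_le_iff₀ (by linarith)]
    nlinarith
  -- There are `2q + 2 ≤ 4q` values per coordinate, and every grid point whose hat is nonzero
  -- somewhere on `X` is included.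
  let S : Finset (Fin d → ℤ) :=
    Fintype.piFinset fun i => Finset.Icc (⌊ρ * x₀ i⌋ - q) (⌊ρ * x₀ i⌋ + q + 1)
  let near : (Fin d → ℤ) → (Fin d → ℝ) → Prop := fun j x => x ∈ X ∧ ∀ i, |ρ * x i - j i| < 1
  have hdist : ∀ x ∈ X, ∀ i, |x i - x₀ i| ≤ D := fun x hx i =>
    ((dist_le_pi_dist x x₀ i).trans (Metric.dist_le_diam_of_mem hX hx hx₀)).trans hD
  -- The interpolated functions are controlled on `X` only, so the sample point of a hat must lie in
  -- `X` rather than at the grid point. The default `x₀` serves hats that vanish on `X`.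
  let ξ : S → Fin d → ℝ := fun j => if h : ∃ x, near j x then h.choose else x₀
  have hξ : ∀ j : S, ∀ x, near j x → near j (ξ j) := by
    intro j x hx
    have h : ∃ x, near j x := ⟨x, hx⟩
    simp only [ξ, dif_pos h]
    exact h.choose_spec
  refine ⟨S, inferInstance, fun j => hat ρ (fun i => j.1 i), ξ, ?_, fun j x => hat_nonneg _ _ _,
    ?_, ?_, ?_⟩
  · intro j
    by_cases h : ∃ x, near j x
    · exact (hξ j _ h.choose_spec).1
    · simpa only [ξ, dif_neg h] using hx₀
  · intro x hx
    rw [Finset.sum_coe_sort S (fun j : Fin d → ℤ => hat ρ (fun i => (j i : ℝ)) x)]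
    refine sum_hat_eq_one ρ S x fun j hj => ?_
    refine Fintype.mem_piFinset.mpr fun i => Finset.mem_Icc.mpr ?_
    have h1 := abs_lt.mp (hj i)
    have h2 := abs_le.mp (hdist x hx i)
    have h3 := Int.floor_le (ρ * x₀ i)
    have h4 := Int.lt_floor_add_one (ρ * x₀ i)
    have h5 : ρ * (x i - x₀ i) ≤ q := (mul_le_mul_of_nonneg_left h2.2 hρ0.le).trans hρD
    have h6 : -q ≤ ρ * (x i - x₀ i) := by
      have := mul_le_mul_of_nonneg_left h2.1 hρ0.le
      linarith
    constructor
    · have : (⌊ρ * x₀ i⌋ : ℝ) - q - 1 < j i := by linarith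
      have : ⌊ρ * x₀ i⌋ - q - 1 < j i := by exact_mod_cast this
      omega
    · have : (j i : ℝ) < (⌊ρ * x₀ i⌋ : ℝ) + q + 2 := by linarith
      have : j i < ⌊ρ * x₀ i⌋ + q + 2 := by exact_mod_cast this
      omega
  · intro x hx j hj
    have h1 := abs_sub_lt_one_of_hat_ne_zero hj
    have h2 := hξ j x ⟨hx, h1⟩
    refine (dist_pi_le_iff (by positivity)).mpr fun i => ?_
    have h3 := abs_lt.mp (h1 i)
    have h4 := abs_lt.mp (h2.2 i)
    rw [Real.dist_eq]
    have h5 : ρ * |x i - ξ j i| ≤ 2 := by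
      calc ρ * |x i - ξ j i| = |ρ * (x i - ξ j i)| := by rw [abs_mul, abs_of_pos hρ0]
        _ ≤ 2 := abs_le.mpr ⟨by linarith, by linarith⟩
    rw [show 2 * ((D + 1) / q) = 2 / ρ by rw [hρ]; field_simp, le_div_iff₀ hρ0]
    linarith
  · intro n W L w hW h3 hw hn hL c hc
    have hx₀q : ∀ i, |ρ * x₀ i| ≤ q * ‖x₀‖ := fun i => by
      rw [abs_mul, abs_of_pos hρ0]
      exact mul_le_mul hρq (norm_le_pi_norm x₀ i) (abs_nonneg _) (by linarith)
    refine (isHidden_hat (J := S) (ρ := ρ) hW h3 ?_ (fun j i => (j.1 i : ℝ)) ?_ ?_).isReLUNet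
      hW hL c hc
    · rw [abs_of_pos hρ0]
      nlinarith [norm_nonneg x₀]
    · intro j i
      have h1 := Finset.mem_Icc.mp (Fintype.mem_piFinset.mp j.2 i)
      have h2 : (⌊ρ * x₀ i⌋ : ℝ) - q ≤ j.1 i := by exact_mod_cast h1.1
      have h2' : (j.1 i : ℝ) ≤ (⌊ρ * x₀ i⌋ : ℝ) + q + 1 := by exact_mod_cast h1.2
      have h3 := Int.floor_le (ρ * x₀ i)
      have h4 := Int.lt_floor_add_one (ρ * x₀ i)
      have h5 := abs_le.mp (hx₀q i)
      rw [abs_le]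
      constructor <;> linarith
    · refine le_trans (Nat.mul_le_mul_right _ ?_) hn
      rw [Fintype.card_coe, Fintype.card_piFinset]
      refine (Finset.prod_le_pow_card _ _ (4 * q) fun i _ => ?_).trans (by simp)
      rw [Int.card_Icc]
      omega

/-! ### Bernstein's inequality with exponentially weighted second moments -/

theorem exp_le_one_add_add_sq_mul_exp (x : ℝ) :
    Real.exp x ≤ 1 + x + x ^ 2 * Real.exp |x| := by
  have h := Complex.norm_exp_sub_sum_le_norm_mul_exp (x : ℂ) 2
  simp only [Finset.sum_range_succ, Finset.sum_range_zero, pow_zero, Nat.factorial_zero,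
    Nat.cast_one, div_one, pow_one, Nat.factorial_one, zero_add] at h
  have h2 : ((Real.exp x - (1 + x) : ℝ) : ℂ) = Complex.exp x - (1 + x) := by push_cast; ring
  rw [← h2, Complex.norm_real, Complex.norm_real, Real.norm_eq_abs, Real.norm_eq_abs, sq_abs] at h
  linarith [le_abs_self (Real.exp x - (1 + x))]

section Bernstein

variable {Z : Type*} [MeasurableSpace Z] {P : Measure Z}

theorem integrable_of_integrable_sq_mul_exp [IsProbabilityMeasure P] {D : Z → ℝ} (hD : Measurable D) {a : ℝ} (ha : 0 ≤ a)
    (hi : Integrable (fun z => D z ^ 2 * Real.exp (a * |D z|)) P) : Integrable D P := by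
  refine ((integrable_const (1 : ℝ)).add hi).mono' hD.aestronglyMeasurable
    (Filter.Eventually.of_forall fun z => ?_)
  have h1 : 1 ≤ Real.exp (a * |D z|) := Real.one_le_exp (by positivity)
  simp only [Pi.add_apply, Real.norm_eq_abs]
  nlinarith [sq_abs (D z), sq_nonneg (|D z| - 1), sq_nonneg (D z)]

/-- Integrating the second-order bound for `exp` gives `1 + l μ + l² v ≤ exp (l μ + l² v)`, and
centring removes `l μ`. The condition `l ≤ a` lets one weight `exp (a |D|)` serve every `l`. -/
theorem lintegral_exp_le [IsProbabilityMeasure P] {D : Z → ℝ} (hD : Measurable D) {a v l : ℝ} (hl : 0 < l) (hla : l ≤ a)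
    (hi : Integrable (fun z => D z ^ 2 * Real.exp (a * |D z|)) P)
    (hv : ∫ z, D z ^ 2 * Real.exp (a * |D z|) ∂P ≤ v) :
    ∫⁻ z, ENNReal.ofReal (Real.exp (l * (D z - ∫ z, D z ∂P))) ∂P ≤
      ENNReal.ofReal (Real.exp (l ^ 2 * v)) := by
  have hDi := integrable_of_integrable_sq_mul_exp hD (hl.le.trans hla) hi
  set μ := ∫ z, D z ∂P with hμ
  have hb : ∀ z, Real.exp (l * D z) ≤
      1 + l * D z + l ^ 2 * (D z ^ 2 * Real.exp (a * |D z|)) := fun z => by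
    refine (exp_le_one_add_add_sq_mul_exp _).trans ?_
    rw [mul_pow, mul_assoc, abs_mul, abs_of_pos hl]
    gcongr
  have hBi : Integrable (fun z => 1 + l * D z + l ^ 2 * (D z ^ 2 * Real.exp (a * |D z|))) P :=
    ((integrable_const _).add (hDi.const_mul _)).add (hi.const_mul _)
  calc ∫⁻ z, ENNReal.ofReal (Real.exp (l * (D z - μ))) ∂P
      ≤ ∫⁻ z, ENNReal.ofReal (Real.exp (-(l * μ)) *
          (1 + l * D z + l ^ 2 * (D z ^ 2 * Real.exp (a * |D z|)))) ∂P := by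
        refine lintegral_mono fun z => ENNReal.ofReal_le_ofReal ?_
        rw [mul_sub, sub_eq_neg_add, Real.exp_add]
        exact mul_le_mul_of_nonneg_left (hb z) (Real.exp_pos _).le
    _ = ENNReal.ofReal (∫ z, Real.exp (-(l * μ)) *
          (1 + l * D z + l ^ 2 * (D z ^ 2 * Real.exp (a * |D z|))) ∂P) := by
        rw [ofReal_integral_eq_lintegral_ofReal (hBi.const_mul _)]
        exact Filter.Eventually.of_forall fun z =>
          mul_nonneg (Real.exp_pos _).le ((Real.exp_pos _).le.trans (hb z))
    _ ≤ _ := by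
        refine ENNReal.ofReal_le_ofReal ?_
        have hlin : ∫ z, (1 + l * D z + l ^ 2 * (D z ^ 2 * Real.exp (a * |D z|))) ∂P =
            1 + l * μ + l ^ 2 * ∫ z, D z ^ 2 * Real.exp (a * |D z|) ∂P := by
          have hi1 : Integrable (fun z => 1 + l * D z) P :=
            (integrable_const _).add (hDi.const_mul _)
          rw [integral_add hi1 (hi.const_mul _),
            integral_add (integrable_const _) (hDi.const_mul _),
            integral_const_mul, integral_const_mul, ← hμ]
          simp
        rw [integral_const_mul, hlin]
        have h1 : 1 + l * μ + l ^ 2 * ∫ z, D z ^ 2 * Real.exp (a * |D z|) ∂P ≤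
            Real.exp (l * μ + l ^ 2 * v) := by
          have := Real.add_one_le_exp (l * μ + l ^ 2 * v)
          nlinarith [sq_nonneg l]
        calc _ ≤ Real.exp (-(l * μ)) * Real.exp (l * μ + l ^ 2 * v) :=
              mul_le_mul_of_nonneg_left h1 (Real.exp_pos _).le
          _ = _ := by rw [← Real.exp_add]; congr 1; ring

/-- Deviation of the empirical mean of `D` over the sample `z` from its expectation. -/
noncomputable def deviation (P : Measure Z) {N : ℕ} (z : Fin N → Z) (D : Z → ℝ) : ℝ :=
  (1 / (N : ℝ)) * ∑ i, D (z i) - ∫ x, D x ∂P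

theorem measurable_deviation {N : ℕ} {D : Z → ℝ} (hD : Measurable D) :
    Measurable fun z : Fin N → Z => deviation P z D := by
  unfold deviation
  fun_prop

/-- A one-sided Bernstein inequality. -/
theorem measure_deviation_gt_le [IsProbabilityMeasure P] {D : Z → ℝ} (hD : Measurable D) {a v l u : ℝ} (hl : 0 < l)
    (hla : l ≤ a) (hi : Integrable (fun z => D z ^ 2 * Real.exp (a * |D z|)) P)
    (hv : ∫ z, D z ^ 2 * Real.exp (a * |D z|) ∂P ≤ v) {N : ℕ} (hN : 1 ≤ N) :
    Measure.pi (fun _ : Fin N => P) {z | l * v + u / (l * N) < deviation P z D} ≤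
      ENNReal.ofReal (Real.exp (-u)) := by
  have hN0 : (0 : ℝ) < N := by exact_mod_cast hN
  set μ := ∫ z, D z ∂P with hμ
  set g : Z → ℝ≥0∞ := fun z => ENNReal.ofReal (Real.exp (l * (D z - μ))) with hg
  have hgm : Measurable g := by fun_prop
  -- This is `l * N` times the threshold. After Markov's inequality the moment bound cancels `N * (l
  -- ^ 2 * v)` and `exp (-u)` remains. The parameter `l` is left free for the chaining to choose.
  set c : ℝ := N * (l ^ 2 * v) + u with hc
  have hsub : {z : Fin N → Z | l * v + u / (l * N) < deviation P z D} ⊆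
      {z | ENNReal.ofReal (Real.exp c) ≤ ∏ i, g (z i)} := by
    intro z hz
    simp only [mem_ofPred_eq, hg] at hz ⊢
    rw [← ENNReal.ofReal_prod_of_nonneg fun i _ => (Real.exp_pos _).le, ← Real.exp_sum]
    refine ENNReal.ofReal_le_ofReal (Real.exp_le_exp.mpr ?_)
    have h1 : ∑ i, l * (D (z i) - μ) = l * N * deviation P z D := by
      rw [deviation, ← Finset.mul_sum, Finset.sum_sub_distrib, Finset.sum_const, Finset.card_univ,
        Fintype.card_fin, nsmul_eq_mul]
      field_simp
      rw [hμ]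
    rw [h1]
    have h2 := mul_le_mul_of_nonneg_left hz.le (by positivity : 0 ≤ l * N)
    refine le_trans (le_of_eq ?_) h2
    rw [hc]; field_simp
  refine (measure_mono hsub).trans ?_
  have hmk := meas_ge_le_lintegral_div (μ := Measure.pi (fun _ : Fin N => P))
    (f := fun z => ∏ i, g (z i)) 
    (Finset.measurable_fun_prod _ fun i _ => hgm.comp (measurable_pi_apply i)).aemeasurable
    (ε := ENNReal.ofReal (Real.exp c))
    (by simpa using Real.exp_pos c) ENNReal.ofReal_ne_top
  refine hmk.trans ?_
  have hprod : ∫⁻ z, ∏ i, g (z i) ∂(Measure.pi (fun _ : Fin N => P)) = (∫⁻ z, g z ∂P) ^ N := by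
    have hgi : Integrable (fun z => Real.exp (l * (D z - μ))) P :=
      ⟨by fun_prop, by
        rw [hasFiniteIntegral_iff_ofReal (Filter.Eventually.of_forall fun z => (Real.exp_pos _).le)]
        exact (lintegral_exp_le hD hl hla hi hv).trans_lt ENNReal.ofReal_lt_top⟩
    simp only [hg]
    simp_rw [← ENNReal.ofReal_prod_of_nonneg fun i (_ : i ∈ Finset.univ) =>
      (Real.exp_pos (l * (D _ - μ))).le]
    rw [← ofReal_integral_eq_lintegral_ofReal (Integrable.fintype_prod fun _ => hgi)
        (Filter.Eventually.of_forall fun z => Finset.prod_nonneg fun i _ => (Real.exp_pos _).le),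
      ← ofReal_integral_eq_lintegral_ofReal hgi
        (Filter.Eventually.of_forall fun z => (Real.exp_pos _).le),
      integral_fintype_prod_eq_pow (ι := Fin N) (fun z => Real.exp (l * (D z - μ))),
      Fintype.card_fin, ENNReal.ofReal_pow (integral_nonneg fun z => (Real.exp_pos _).le)]
  rw [hprod]
  refine ENNReal.div_le_of_le_mul ?_
  refine (pow_le_pow_left' (lintegral_exp_le hD hl hla hi hv) N).trans (le_of_eq ?_)
  rw [← ENNReal.ofReal_pow (Real.exp_pos _).le, ← Real.exp_nat_mul,
    ← ENNReal.ofReal_mul (Real.exp_pos _).le, ← Real.exp_add, hc]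
  congr 2
  ring

end Bernstein

/-! ### Moments of the envelope -/

/-- Bound for the difference of two log-densities that are at distance `τ ^ p` and take values in
`[exp (-V), exp V]`. -/
noncomputable def envelope (p : ℕ) (τ V : ℝ) : ℝ := min (τ ^ p * Real.exp V) (2 * V)

/-- With `u = τ exp (V / p)` the envelope is `min (u ^ p) (2 V)`. If `u ≥ 1` the second entry is at
most `u * 2V`; if `u ≤ 1`, then `u ^ p ≤ u`. This trades the full power of `τ` for a small exponent
of `V`. -/
theorem envelope_le_mul {p : ℕ} (hp : 1 ≤ p) {τ V : ℝ} (hτ : 0 ≤ τ) (hV : 1 ≤ V) :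
    envelope p τ V ≤ τ * Real.exp (V / p) * (2 * V) := by
  have hp0 : (p : ℝ) ≠ 0 := by positivity
  have hu : (τ * Real.exp (V / p)) ^ p = τ ^ p * Real.exp V := by
    rw [mul_pow, ← Real.exp_nat_mul, mul_div_cancel₀ _ hp0]
  have hu0 : 0 ≤ τ * Real.exp (V / p) := by positivity
  rw [envelope, ← hu]
  rcases le_total 1 (τ * Real.exp (V / p)) with h | h
  · exact (min_le_right _ _).trans (le_mul_of_one_le_left (by linarith) h)
  · refine (min_le_left _ _).trans ?_
    have := pow_le_of_le_one hu0 h (by omega : p ≠ 0)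
    nlinarith

theorem envelope_nonneg (p : ℕ) {τ V : ℝ} (hτ : 0 ≤ τ) (hV : 0 ≤ V) : 0 ≤ envelope p τ V :=
  le_min (by positivity) (by positivity)

/-- The budget `exp (lam V)` is spent as follows: a quarter on the square of `exp (V / p) ≤ exp (lam
V / 8)`, half on `V² ≤ (16 / lam²) exp (lam V / 2)`, and a quarter on `exp (lam |D| / 8)`, using
`|D| ≤ 2V`. -/
theorem sq_mul_exp_le_of_abs_le_envelope {p : ℕ} (hp : 1 ≤ p) {lam τ V D : ℝ} (hlam : 0 < lam)
    (hpl : 8 ≤ lam * p) (hτ : 0 ≤ τ) (hV : 1 ≤ V) (hD : |D| ≤ envelope p τ V) :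
    D ^ 2 * Real.exp (lam / 8 * |D|) ≤ 64 / lam ^ 2 * τ ^ 2 * Real.exp (lam * V) := by
  have hp0 : (0 : ℝ) < p := by positivity
  have h1 : |D| ≤ τ * Real.exp (lam / 8 * V) * (2 * V) := by
    refine (hD.trans (envelope_le_mul hp hτ hV)).trans ?_
    gcongr
    rw [div_le_iff₀ hp0]
    nlinarith
  have h2 : |D| ≤ 2 * V := hD.trans (min_le_right _ _)
  have h3 : V ≤ 4 / lam * Real.exp (lam / 4 * V) := by
    have := Real.add_one_le_exp (lam / 4 * V)
    rw [div_mul_eq_mul_div, le_div_iff₀ hlam]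
    linarith
  calc D ^ 2 * Real.exp (lam / 8 * |D|)
      ≤ (τ * Real.exp (lam / 8 * V) * (2 * (4 / lam * Real.exp (lam / 4 * V)))) ^ 2 *
        Real.exp (lam / 8 * (2 * V)) := by
        rw [← sq_abs D]
        gcongr
        exact h1.trans (by gcongr)
    _ = 64 / lam ^ 2 * τ ^ 2 * (Real.exp (lam / 8 * V) ^ 2 * Real.exp (lam / 4 * V) ^ 2 *
        Real.exp (lam / 8 * (2 * V))) := by ring
    _ = _ := by
        rw [← Real.exp_nat_mul, ← Real.exp_nat_mul, ← Real.exp_add, ← Real.exp_add]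
        congr 2
        push_cast
        ring

section Envelope

variable {Z : Type*} [MeasurableSpace Z] {P : Measure Z} {p : ℕ} {lam Q τ : ℝ} {V D : Z → ℝ}

theorem integrable_sq_mul_exp (hp : 1 ≤ p) (hlam : 0 < lam) (hpl : 8 ≤ lam * p) (hτ : 0 ≤ τ)
    (hV : ∀ z, 1 ≤ V z) (hi : Integrable (fun z => Real.exp (lam * V z)) P) (hDm : Measurable D)
    (hD : ∀ᵐ z ∂P, |D z| ≤ envelope p τ (V z)) :
    Integrable (fun z => D z ^ 2 * Real.exp (lam / 8 * |D z|)) P := by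
  have hm : Measurable fun z => D z ^ 2 * Real.exp (lam / 8 * |D z|) := by
    have := hDm.abs
    fun_prop
  refine (hi.const_mul (64 / lam ^ 2 * τ ^ 2)).mono' hm.aestronglyMeasurable ?_
  filter_upwards [hD] with z hz
  rw [Real.norm_of_nonneg (by positivity)]
  exact sq_mul_exp_le_of_abs_le_envelope hp hlam hpl hτ (hV z) hz

theorem integral_sq_mul_exp_le (hp : 1 ≤ p) (hlam : 0 < lam) (hpl : 8 ≤ lam * p) (hτ : 0 ≤ τ)
    (hV : ∀ z, 1 ≤ V z) (hi : Integrable (fun z => Real.exp (lam * V z)) P)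
    (hQ : ∫ z, Real.exp (lam * V z) ∂P ≤ Q) (hDm : Measurable D)
    (hD : ∀ᵐ z ∂P, |D z| ≤ envelope p τ (V z)) :
    ∫ z, D z ^ 2 * Real.exp (lam / 8 * |D z|) ∂P ≤ 64 / lam ^ 2 * Q * τ ^ 2 := by
  calc _ ≤ ∫ z, 64 / lam ^ 2 * τ ^ 2 * Real.exp (lam * V z) ∂P := by
        refine integral_mono_ae (integrable_sq_mul_exp hp hlam hpl hτ hV hi hDm hD)
          (hi.const_mul _) ?_
        filter_upwards [hD] with z hz
        exact sq_mul_exp_le_of_abs_le_envelope hp hlam hpl hτ (hV z) hz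
    _ ≤ _ := by
        rw [integral_const_mul]
        have : 0 ≤ 64 / lam ^ 2 * τ ^ 2 := by positivity
        nlinarith

/-- From `e ≤ τ + e² / τ`, the second moment of order `τ²` forces a mean of order `τ`. This bounds
what is left where the chaining stops. -/
theorem integral_envelope_le [IsProbabilityMeasure P] (hp : 1 ≤ p) (hlam : 0 < lam)
    (hpl : 8 ≤ lam * p) (hτ : 0 < τ) (hVm : Measurable V)
    (hV : ∀ z, 1 ≤ V z) (hi : Integrable (fun z => Real.exp (lam * V z)) P)
    (hQ : ∫ z, Real.exp (lam * V z) ∂P ≤ Q) :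
    ∫ z, envelope p τ (V z) ∂P ≤ (1 + 64 / lam ^ 2 * Q) * τ := by
  have hm : Measurable fun z => envelope p τ (V z) := by unfold envelope; fun_prop
  have h0 : ∀ z, 0 ≤ envelope p τ (V z) := fun z =>
    envelope_nonneg p hτ.le (zero_le_one.trans (hV z))
  have hD : ∀ᵐ z ∂P, |envelope p τ (V z)| ≤ envelope p τ (V z) :=
    Filter.Eventually.of_forall fun z => (abs_of_nonneg (h0 z)).le
  have hint := integrable_sq_mul_exp hp hlam hpl hτ.le hV hi hm hD
  have hle := integral_sq_mul_exp_le hp hlam hpl hτ.le hV hi hQ hm hD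
  calc ∫ z, envelope p τ (V z) ∂P
      ≤ ∫ z, (τ + τ⁻¹ * (envelope p τ (V z) ^ 2 *
          Real.exp (lam / 8 * |envelope p τ (V z)|))) ∂P := by
        refine integral_mono (integrable_of_integrable_sq_mul_exp hm (by positivity) hint)
          ((integrable_const _).add (hint.const_mul _)) fun z => ?_
        have h1 : 1 ≤ Real.exp (lam / 8 * |envelope p τ (V z)|) :=
          Real.one_le_exp (by positivity)
        set e := envelope p τ (V z)
        have h2 : e ≤ τ + τ⁻¹ * e ^ 2 := by
          rw [inv_mul_eq_div, ← sub_le_iff_le_add', le_div_iff₀ hτ]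
          nlinarith [sq_nonneg (e - τ), sq_nonneg e]
        refine h2.trans ?_
        gcongr
        exact le_mul_of_one_le_right (sq_nonneg _) h1
    _ = τ + τ⁻¹ * ∫ z, envelope p τ (V z) ^ 2 *
          Real.exp (lam / 8 * |envelope p τ (V z)|) ∂P := by
        rw [integral_add (integrable_const _) (hint.const_mul _), integral_const_mul]
        simp
    _ ≤ τ + τ⁻¹ * (64 / lam ^ 2 * Q * τ ^ 2) := by gcongr
    _ = _ := by field_simp

end Envelope

/-! ### Chaining for log-likelihoods -/

theorem sum_chain_le (α β : ℝ) (hα : 0 ≤ α) (hβ : 0 ≤ β) (m : ℕ) :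
    ∑ k ∈ Finset.range m, (1 / 2 : ℝ) ^ (k + 1) * (α + β * (k + 1)) ≤ α + 2 * β := by
  have : ∀ m : ℕ, ∑ k ∈ Finset.range m, (1 / 2 : ℝ) ^ (k + 1) * (α + β * (k + 1)) =
      α + 2 * β - (1 / 2 : ℝ) ^ m * (α + β * (m + 2)) := by
    intro m
    induction m with
    | zero => simp; ring
    | succ m ih =>
      rw [Finset.sum_range_succ, ih]
      push_cast
      ring
  rw [this]
  have : 0 ≤ (1 / 2 : ℝ) ^ m * (α + β * (m + 2)) := by positivity
  linarith

theorem abs_log_sub_log_le {a b v : ℝ} (ha : Real.exp (-v) ≤ a) (hb : Real.exp (-v) ≤ b) :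
    |Real.log a - Real.log b| ≤ |a - b| * Real.exp v := by
  have key : ∀ a b : ℝ, Real.exp (-v) ≤ a → Real.exp (-v) ≤ b →
      Real.log a - Real.log b ≤ |a - b| * Real.exp v := by
    intro a b ha hb
    have ha0 := (Real.exp_pos _).trans_le ha
    have hb0 := (Real.exp_pos _).trans_le hb
    rw [← Real.log_div ha0.ne' hb0.ne']
    calc Real.log (a / b) ≤ a / b - 1 := Real.log_le_sub_one_of_pos (by positivity)
      _ = (a - b) * b⁻¹ := by field_simp
      _ ≤ |a - b| * Real.exp v := by
        gcongr
        · exact le_abs_self _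
        · rw [← neg_neg v, Real.exp_neg (-v)]
          gcongr
  rw [abs_le]
  constructor
  · have := key b a hb ha
    rw [abs_sub_comm] at this
    linarith
  · exact key a b ha hb

theorem abs_log_le {a v : ℝ} (ha : Real.exp (-v) ≤ a) (ha' : a ≤ Real.exp v) :
    |Real.log a| ≤ v := by
  have ha0 := (Real.exp_pos _).trans_le ha
  rw [abs_le]
  exact ⟨(Real.le_log_iff_exp_le ha0).mpr ha, (Real.log_le_iff_le_exp ha0).mpr ha'⟩

theorem deviation_sub {Z : Type*} [MeasurableSpace Z] {P : Measure Z} {N : ℕ} {z : Fin N → Z}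
    {f g : Z → ℝ} (hf : Integrable f P) (hg : Integrable g P) :
    deviation P z (fun x => f x - g x) = deviation P z f - deviation P z g := by
  rw [deviation, deviation, deviation, integral_sub hf hg, Finset.sum_sub_distrib]
  ring

/-- The dominating `H` does not depend on `f`, so one event for `H` controls the last link of the
chain for the whole class at once. -/
theorem deviation_le_of_abs_le {Z : Type*} [MeasurableSpace Z] {P : Measure Z} {N : ℕ}
    {z : Fin N → Z} {f H : Z → ℝ} (hH : Integrable H P) (hz : ∀ i, |f (z i)| ≤ H (z i))
    (hae : ∀ᵐ x ∂P, |f x| ≤ H x) :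
    deviation P z f ≤ deviation P z H + 2 * ∫ x, H x ∂P := by
  have h1 : ∑ i, f (z i) ≤ ∑ i, H (z i) :=
    Finset.sum_le_sum fun i _ => (le_abs_self _).trans (hz i)
  have h2 : ‖∫ x, f x ∂P‖ ≤ ∫ x, H x ∂P := norm_integral_le_of_norm_le hH hae
  rw [Real.norm_eq_abs] at h2
  have h3 := mul_le_mul_of_nonneg_left h1 (by positivity : (0 : ℝ) ≤ 1 / N)
  rw [deviation, deviation]
  linarith [(abs_le.mp h2).1]

section Nets

variable {Z Θ : Type*} {S : Set Z} {F : Set Θ} {f : Θ → Z → ℝ} {θ₀ : Θ} {c : ℝ} {p : ℕ}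

/-- From external covers to nets inside the class. -/
theorem exists_internal_nets (hθ₀ : θ₀ ∈ F) (hc : 0 ≤ c) (hp : 1 ≤ p)
    (hcov : ∀ η ∈ Ioc (0 : ℝ) (1 / 2), ∃ t : Finset (Z → ℝ), (t.card : ℝ) ≤ (1 / η) ^ c ∧
      ∀ θ ∈ F, ∃ g ∈ t, ∀ z ∈ S, |f θ z - g z| ≤ η) :
    ∃ T : ℕ → Finset Θ, T 0 = {θ₀} ∧ (∀ k, ∀ a ∈ T k, a ∈ F) ∧
      (∀ k, ((T k).card : ℝ) ≤ Real.exp (p * k * c)) ∧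
      ∀ k, ∀ θ ∈ F, ∃ a ∈ T k, k ≠ 0 → ∀ z ∈ S, |f θ z - f a z| ≤ 2 * (1 / 2) ^ (p * k) := by
  classical
  have key : ∀ k : ℕ, ∃ T : Finset Θ, (k = 0 → T = {θ₀}) ∧ (∀ a ∈ T, a ∈ F) ∧
      ((T.card : ℝ) ≤ Real.exp (p * k * c)) ∧
      ∀ θ ∈ F, ∃ a ∈ T, k ≠ 0 → ∀ z ∈ S, |f θ z - f a z| ≤ 2 * (1 / 2) ^ (p * k) := by
    intro k
    rcases Nat.eq_zero_or_pos k with rfl | hk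
    · exact ⟨{θ₀}, fun _ => rfl, by simpa using hθ₀, by simp, fun θ _ => ⟨θ₀, by simp⟩⟩
    set η : ℝ := (1 / 2) ^ (p * k) with hη
    have hpk : p * k ≠ 0 := by positivity
    obtain ⟨t, htc, ht⟩ := hcov η ⟨by positivity, pow_le_of_le_one (by norm_num) (by norm_num) hpk⟩
    -- Centres of the given covers are arbitrary functions, perhaps not positive. Replacing each by
    -- a nearby member of `F` doubles the radius and makes its logarithm usable.
    let pick : (Z → ℝ) → Θ := fun g =>
      if h : ∃ θ ∈ F, ∀ z ∈ S, |f θ z - g z| ≤ η then h.choose else θ₀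
    refine ⟨t.image pick, fun h => absurd h hk.ne', ?_, ?_, ?_⟩
    · intro a ha
      obtain ⟨g, -, rfl⟩ := Finset.mem_image.mp ha
      by_cases h : ∃ θ ∈ F, ∀ z ∈ S, |f θ z - g z| ≤ η
      · simp only [pick, dif_pos h]
        exact h.choose_spec.1
      · simpa only [pick, dif_neg h] using hθ₀
    · have h1 : ((t.image pick).card : ℝ) ≤ t.card := by exact_mod_cast Finset.card_image_le
      refine (h1.trans htc).trans ?_
      have h2 : 1 / η = Real.exp ((p * k : ℕ) * Real.log 2) := by
        rw [Real.exp_nat_mul, Real.exp_log two_pos, hη]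
        simp
      rw [h2, ← Real.exp_mul]
      refine Real.exp_le_exp.mpr ?_
      push_cast
      have h3 : Real.log 2 ≤ 1 := by linarith [Real.log_two_lt_d9]
      have h4 : (0 : ℝ) ≤ p * k := by positivity
      exact mul_le_mul_of_nonneg_right (mul_le_of_le_one_right h4 h3) hc
    · intro θ hθ
      obtain ⟨g, hg, hgz⟩ := ht θ hθ
      refine ⟨pick g, Finset.mem_image_of_mem _ hg, fun _ z hz => ?_⟩
      have h : ∃ θ ∈ F, ∀ z ∈ S, |f θ z - g z| ≤ η := ⟨θ, hθ, hgz⟩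
      have hpick := h.choose_spec.2 z hz
      simp only [pick, dif_pos h]
      have := hgz z hz
      rw [abs_sub_comm] at hpick
      calc _ ≤ |f θ z - g z| + |g z - f h.choose z| := abs_sub_le _ _ _
        _ ≤ _ := by linarith
  choose T hT using key
  exact ⟨T, (hT 0).1 rfl, fun k => (hT k).2.1, fun k => (hT k).2.2.1, fun k => (hT k).2.2.2⟩

/-- No closeness is needed at level 0, since `4 ^ p * exp V ≥ 2 * V` already. At higher levels `4 ≤
4 ^ p` turns the distance `4 * (1/2)^(pk)` into a `p`-th power. -/
theorem abs_log_sub_log_le_envelope (hp : 1 ≤ p) {V a b : ℝ} (hV : 1 ≤ V) {k : ℕ}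
    (ha : Real.exp (-V) ≤ a) (ha' : a ≤ Real.exp V) (hb : Real.exp (-V) ≤ b)
    (hb' : b ≤ Real.exp V) (hab : k ≠ 0 → |a - b| ≤ 4 * (1 / 2) ^ (p * k)) :
    |Real.log a - Real.log b| ≤ envelope p (4 * (1 / 2) ^ k) V := by
  have h2 : |Real.log a - Real.log b| ≤ 2 * V := by
    have h := abs_sub (Real.log a) (Real.log b)
    linarith [abs_log_le ha ha', abs_log_le hb hb']
  refine le_min ?_ h2
  have h4 : (4 : ℝ) ≤ 4 ^ p := le_self_pow₀ (by norm_num) (by omega)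
  rcases eq_or_ne k 0 with rfl | hk
  · refine h2.trans ?_
    have := Real.add_one_le_exp V
    rw [pow_zero, mul_one]
    nlinarith
  · refine (abs_log_sub_log_le ha hb).trans ?_
    gcongr
    refine (hab hk).trans ?_
    rw [mul_pow, ← pow_mul, mul_comm k p]
    gcongr

end Nets

theorem exists_dyadic_level {t : ℝ} (ht : 0 < t) (ht1 : t ≤ 1) :
    ∃ m : ℕ, 2 ^ m * t ≤ 1 ∧ (1 / 2) ^ m ≤ 2 * t := by
  obtain ⟨m, h1, h2⟩ := exists_nat_pow_near (one_le_one_div ht ht1) (one_lt_two (α := ℝ))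
  refine ⟨m, by rwa [le_div_iff₀ ht] at h1, ?_⟩
  rw [div_lt_iff₀ ht, pow_succ] at h2
  rw [one_div, inv_pow, inv_le_iff_one_le_mul₀' (by positivity)]
  linarith

/-- Uniform deviation bound for log-likelihoods over a class with polynomial covering numbers. -/
theorem exists_uniform_deviation_event {lam Q : ℝ} (hlam : 0 < lam) (hQ0 : 0 ≤ Q) :
    ∃ C : ℝ, 0 < C ∧ ∀ {Z Θ : Type} [MeasurableSpace Z] (P : Measure Z) [IsProbabilityMeasure P]
      (V : Z → ℝ) (S : Set Z) (F : Set Θ) (f : Θ → Z → ℝ) (θ₀ : Θ) (c δ : ℝ) (N : ℕ),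
      Measurable V → (∀ z, 1 ≤ V z) → Integrable (fun z => Real.exp (lam * V z)) P →
      ∫ z, Real.exp (lam * V z) ∂P ≤ Q → MeasurableSet S → P Sᶜ = 0 →
      (∀ θ ∈ F, Measurable (f θ)) →
      (∀ θ ∈ F, ∀ z ∈ S, Real.exp (-V z) ≤ f θ z ∧ f θ z ≤ Real.exp (V z)) → θ₀ ∈ F →
      1 ≤ c →
      (∀ η ∈ Ioc (0 : ℝ) (1 / 2), ∃ t : Finset (Z → ℝ), (t.card : ℝ) ≤ (1 / η) ^ c ∧
        ∀ θ ∈ F, ∃ g ∈ t, ∀ z ∈ S, |f θ z - g z| ≤ η) →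
      1 ≤ N → 0 < δ → δ < 1 → (c + Real.log (1 / δ)) / N ≤ 1 →
      ∃ A : Set (Fin N → Z), MeasurableSet A ∧
        ENNReal.ofReal (1 - δ) ≤ Measure.pi (fun _ : Fin N => P) A ∧
        ∀ z ∈ A, (∀ i, z i ∈ S) ∧ ∀ θ ∈ F,
          deviation P z (fun x => Real.log (f θ x)) - deviation P z (fun x => Real.log (f θ₀ x)) ≤
            C * √((c + Real.log (1 / δ)) / N) := by
  -- `p ≥ 8 / lam` ensures `exp (V / p) ≤ exp (lam V / 8)`; the added 1 gives `p ≥ 1`.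
  obtain ⟨p₀, hp₀⟩ := exists_nat_ge (8 / lam)
  set p := p₀ + 1 with hpdef
  have hp : 1 ≤ p := by omega
  have hpl : 8 ≤ lam * p := by
    rw [div_le_iff₀ hlam] at hp₀
    rw [hpdef]; push_cast; nlinarith
  set v : ℝ := 64 / lam ^ 2 * Q with hv
  have hv0 : 0 ≤ v := by positivity
  set a : ℝ := lam / 8 with ha
  have ha0 : 0 < a := by positivity
  -- The first two terms are the value of the arithmetic-geometric sum of the Bernstein thresholds;
  -- the third is `2 (1 + v) τ m` with `τ m ≤ 8 r`.
  refine ⟨32 * a * v + 2 * (2 * (2 * p + 1) / a) + 16 * (1 + v), by positivity, ?_⟩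
  intro Z Θ _ P _ V S F f θ₀ c δ N hVm hV hVi hVQ hS hPS hfm hfb hθ₀ hc hcov hN hδ hδ1 ht1
  have hN0 : (0 : ℝ) < N := by exact_mod_cast hN
  have hlog : 0 < Real.log (1 / δ) := Real.log_pos (by rw [lt_div_iff₀ hδ]; linarith)
  set w : ℝ := c + Real.log (1 / δ) with hw
  have hw0 : 0 < w := by linarith
  set r : ℝ := √(w / N) with hr
  have hr0 : 0 < r := Real.sqrt_pos.mpr (by positivity)
  have hr1 : r ≤ 1 := Real.sqrt_le_one.mpr ht1
  have hrsq : r * r = w / N := Real.mul_self_sqrt (by positivity)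
  obtain ⟨m, hm1, hm2⟩ := exists_dyadic_level hr0 hr1
  obtain ⟨T, hT0, hTF, hTc, hTnet⟩ := exists_internal_nets hθ₀ (by linarith) hp hcov
  let τ : ℕ → ℝ := fun k => 4 * (1 / 2) ^ k
  have hτ : ∀ k, 0 < τ k := fun k => by positivity
  -- This choice balances the two Bernstein terms: `l k * τ k ^ 2` and `u k / (l k * N)` are both of
  -- order `r / 2 ^ k`, up to a factor `k + 1`. The constraint `l k ≤ a` holds exactly as long as `2
  -- ^ k * r ≤ 1`, so the chain stops at `m`.
  let l : ℕ → ℝ := fun k => a * r * 2 ^ k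
  have hl : ∀ k, 0 < l k := fun k => by positivity
  have hla : ∀ k ≤ m, l k ≤ a := fun k hk => by
    have : (2 : ℝ) ^ k ≤ 2 ^ m := pow_le_pow_right₀ one_le_two hk
    have h2 : r * 2 ^ k ≤ 1 := by nlinarith
    simp only [l]; rw [mul_assoc]
    exact mul_le_of_le_one_right ha0.le h2
  -- Of `(k + 1)(2p + 1) w`, the part `p (2k + 1) c` pays for the pairs of net points; because `c ≥
  -- 1`, the rest covers `log (1/δ)` and a factor `2^(-(k+1))`.
  let u : ℕ → ℝ := fun k => (k + 1) * (2 * p + 1) * w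
  let ε : ℕ → ℝ := fun k => l k * (v * τ k ^ 2) + u k / (l k * N)
  have hε : ∀ k, ε k = r * ((1 / 2) ^ (k + 1) * (32 * a * v + 2 * (2 * p + 1) / a * (k + 1))) := by
    intro k
    have h1 : u k / (l k * N) = (k + 1) * (2 * p + 1) * r / (a * 2 ^ k) := by
      simp only [u, l]
      rw [div_eq_div_iff (by positivity) (by positivity)]
      have : w = r * r * N := by rw [hrsq]; field_simp
      rw [this]; ring
    simp only [ε]
    rw [h1]
    simp only [l, τ, one_div, inv_pow]
    field_simp
    ring
  let rel : ℕ → Θ → Θ → Prop := fun k θ θ' =>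
    ∀ z ∈ S, |Real.log (f θ z) - Real.log (f θ' z)| ≤ envelope p (τ k) (V z)
  have hae : ∀ᵐ z ∂P, z ∈ S := mem_ae_iff.mpr hPS
  have hlm : ∀ θ ∈ F, Measurable fun z => Real.log (f θ z) := fun θ hθ => (hfm θ hθ).log
  have hVint : Integrable V P := by
    refine (hVi.const_mul lam⁻¹).mono' hVm.aestronglyMeasurable
      (Filter.Eventually.of_forall fun z => ?_)
    rw [Real.norm_of_nonneg (zero_le_one.trans (hV z)), inv_mul_eq_div, le_div_iff₀ hlam]
    linarith [Real.add_one_le_exp (lam * V z)]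
  have hli : ∀ θ ∈ F, Integrable (fun z => Real.log (f θ z)) P := fun θ hθ => by
    refine hVint.mono' (hlm θ hθ).aestronglyMeasurable ?_
    filter_upwards [hae] with z hz
    exact abs_log_le (hfb θ hθ z hz).1 (hfb θ hθ z hz).2
  let H : Z → ℝ := fun z => envelope p (τ m) (V z)
  have hHm : Measurable H := by simp only [H]; unfold envelope; fun_prop
  have hHabs : ∀ᵐ z ∂P, |H z| ≤ envelope p (τ m) (V z) := Filter.Eventually.of_forall fun z =>
    (abs_of_nonneg (envelope_nonneg p (hτ m).le (zero_le_one.trans (hV z)))).le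
  -- Including `rel` makes the event empty for pairs that are not close, so the union bound may run
  -- over all pairs of consecutive net points.
  let B : ℕ → Θ → Θ → Set (Fin N → Z) := fun k θ θ' =>
    {z | rel k θ θ' ∧ ε k < deviation P z (fun x => Real.log (f θ x) - Real.log (f θ' x))}
  have hBm : ∀ k, ∀ θ ∈ F, ∀ θ' ∈ F, MeasurableSet (B k θ θ') := fun k θ hθ θ' hθ' =>
    (MeasurableSet.const _).inter
      (measurableSet_lt measurable_const (measurable_deviation ((hlm θ hθ).sub (hlm θ' hθ'))))
  have hBμ : ∀ k ≤ m, ∀ θ ∈ F, ∀ θ' ∈ F,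
      Measure.pi (fun _ : Fin N => P) (B k θ θ') ≤ ENNReal.ofReal (Real.exp (-u k)) := by
    intro k hk θ hθ θ' hθ'
    by_cases hrel : rel k θ θ'
    · have hDm : Measurable fun x => Real.log (f θ x) - Real.log (f θ' x) :=
        (hlm θ hθ).sub (hlm θ' hθ')
      have hD : ∀ᵐ z ∂P, |Real.log (f θ z) - Real.log (f θ' z)| ≤ envelope p (τ k) (V z) := by
        filter_upwards [hae] with z hz using hrel z hz
      refine (measure_mono fun z hz => hz.2).trans
        (measure_deviation_gt_le hDm (hl k) (hla k hk)
          (integrable_sq_mul_exp hp hlam hpl (hτ k).le hV hVi hDm hD)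
          (integral_sq_mul_exp_le hp hlam hpl (hτ k).le hV hVi hVQ hDm hD) hN)
    · have : B k θ θ' = ∅ := by
        ext z; simp [B, hrel]
      rw [this, measure_empty]; exact zero_le
  let Bad : ℕ → Set (Fin N → Z) := fun k => ⋃ θ ∈ T (k + 1), ⋃ θ' ∈ T k, B k θ θ'
  have hpiece : ∀ k, Real.exp (p * (k + 1 : ℕ) * c) * (Real.exp (p * k * c) * Real.exp (-u k)) ≤
      δ * (1 / 2) ^ (k + 1) := by
    intro k
    rw [← Real.exp_add, ← Real.exp_add]
    have h1 : Real.exp (-1) ≤ 1 / 2 := by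
      rw [Real.exp_neg, one_div]
      gcongr
      linarith [Real.add_one_le_exp (1 : ℝ)]
    have h2 : Real.exp (-Real.log (1 / δ)) = δ := by
      rw [one_div, Real.log_inv, neg_neg, Real.exp_log hδ]
    calc _ ≤ Real.exp (-Real.log (1 / δ) + (k + 1 : ℕ) * (-1)) := by
          refine Real.exp_le_exp.mpr ?_
          simp only [u, hw]
          push_cast
          have h3 : 0 ≤ (k : ℝ) * (c - 1) := mul_nonneg (by positivity) (by linarith)
          have h4 : 0 ≤ (p : ℝ) * c := by positivity
          have h5 : 0 ≤ ((k : ℝ) + 1) * (2 * p) * Real.log (1 / δ) := by positivity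
          have h6 : 0 ≤ (k : ℝ) * Real.log (1 / δ) := by positivity
          nlinarith
      _ = δ * Real.exp (-1) ^ (k + 1) := by rw [Real.exp_add, h2, Real.exp_nat_mul]
      _ ≤ _ := by gcongr
  have hBadm : ∀ k, MeasurableSet (Bad k) := fun k =>
    Finset.measurableSet_biUnion _ fun θ hθ => Finset.measurableSet_biUnion _ fun θ' hθ' =>
      hBm k θ (hTF _ _ hθ) θ' (hTF _ _ hθ')
  have hBadμ : ∀ k ≤ m, Measure.pi (fun _ : Fin N => P) (Bad k) ≤
      ENNReal.ofReal (δ * (1 / 2) ^ (k + 1)) := by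
    intro k hk
    calc _ ≤ ∑ θ ∈ T (k + 1), ∑ θ' ∈ T k, Measure.pi (fun _ : Fin N => P) (B k θ θ') :=
          (measure_biUnion_finset_le _ _).trans
            (Finset.sum_le_sum fun θ _ => measure_biUnion_finset_le _ _)
      _ ≤ ∑ θ ∈ T (k + 1), ∑ θ' ∈ T k, ENNReal.ofReal (Real.exp (-u k)) :=
          Finset.sum_le_sum fun θ hθ => Finset.sum_le_sum fun θ' hθ' =>
            hBμ k hk θ (hTF _ _ hθ) θ' (hTF _ _ hθ')
      _ = ENNReal.ofReal ((T (k + 1)).card * ((T k).card * Real.exp (-u k))) := by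
          rw [Finset.sum_const, Finset.sum_const, nsmul_eq_mul, nsmul_eq_mul,
            ENNReal.ofReal_mul (by positivity), ENNReal.ofReal_mul (by positivity),
            ENNReal.ofReal_natCast, ENNReal.ofReal_natCast]
      _ ≤ _ := by
          refine ENNReal.ofReal_le_ofReal (le_trans ?_ (hpiece k))
          gcongr
          · exact_mod_cast hTc (k + 1)
          · exact hTc k
  -- The infinitely many links from `θ` to its level-`m` neighbour are handled through the common
  -- envelope `H`. Its share `δ / 2^(m+1)` fits into the geometric budget.
  let Last : Set (Fin N → Z) := {z | ε m < deviation P z H}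
  have hLastm : MeasurableSet Last := measurableSet_lt measurable_const (measurable_deviation hHm)
  have hLastμ : Measure.pi (fun _ : Fin N => P) Last ≤ ENNReal.ofReal (δ * (1 / 2) ^ (m + 1)) := by
    refine (measure_deviation_gt_le hHm (hl m) (hla m le_rfl)
          (integrable_sq_mul_exp hp hlam hpl (hτ m).le hV hVi hHm hHabs)
          (integral_sq_mul_exp_le hp hlam hpl (hτ m).le hV hVi hVQ hHm hHabs) hN).trans
      (ENNReal.ofReal_le_ofReal (le_trans ?_ (hpiece m)))
    have h1 : 1 ≤ Real.exp (p * (m + 1 : ℕ) * c) := Real.one_le_exp (by positivity)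
    have h2 : 1 ≤ Real.exp (p * m * c) := Real.one_le_exp (by positivity)
    exact (le_mul_of_one_le_left (Real.exp_pos _).le h2).trans
      (le_mul_of_one_le_left (by positivity) h1)
  let Out : Set (Fin N → Z) := ⋃ i, (fun z => z i) ⁻¹' Sᶜ
  have hOutm : MeasurableSet Out :=
    MeasurableSet.iUnion fun i => measurable_pi_apply i hS.compl
  have hOutμ : Measure.pi (fun _ : Fin N => P) Out = 0 := by
    refine measure_iUnion_null fun i => ?_
    rw [(measurePreserving_eval (fun _ : Fin N => P) i).measure_preimage
      hS.compl.nullMeasurableSet, hPS]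
  set E : Set (Fin N → Z) := Out ∪ (Last ∪ ⋃ k ∈ Finset.range m, Bad k) with hE
  have hEm : MeasurableSet E :=
    hOutm.union (hLastm.union (Finset.measurableSet_biUnion _ fun k _ => hBadm k))
  have hgeom : ∀ m : ℕ, ∑ k ∈ Finset.range m, δ * (1 / 2) ^ (k + 1) = δ * (1 - (1 / 2) ^ m) := by
    intro m
    induction m with
    | zero => simp
    | succ m ih => rw [Finset.sum_range_succ, ih]; ring
  have hEμ : Measure.pi (fun _ : Fin N => P) E ≤ ENNReal.ofReal δ := by
    refine (measure_union_le _ _).trans ?_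
    rw [hOutμ, zero_add]
    refine (measure_union_le _ _).trans ?_
    calc _ ≤ ENNReal.ofReal (δ * (1 / 2) ^ (m + 1)) +
          ∑ k ∈ Finset.range m, ENNReal.ofReal (δ * (1 / 2) ^ (k + 1)) :=
          add_le_add hLastμ ((measure_biUnion_finset_le _ _).trans
            (Finset.sum_le_sum fun k hk => hBadμ k (Finset.mem_range.mp hk).le))
      _ = ENNReal.ofReal (δ * (1 / 2) ^ (m + 1) + ∑ k ∈ Finset.range m, δ * (1 / 2) ^ (k + 1)) := by
          rw [← ENNReal.ofReal_sum_of_nonneg fun k _ => by positivity,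
            ← ENNReal.ofReal_add (by positivity) (Finset.sum_nonneg fun k _ => by positivity)]
      _ ≤ _ := by
          refine ENNReal.ofReal_le_ofReal ?_
          rw [hgeom, pow_succ]
          have : 0 < δ * (1 / 2) ^ m := by positivity
          linarith
  refine ⟨Eᶜ, hEm.compl, ?_, fun z hz => ?_⟩
  · rw [prob_compl_eq_one_sub hEm, ENNReal.ofReal_sub _ hδ.le, ENNReal.ofReal_one]
    exact tsub_le_tsub_left hEμ 1
  simp only [hE, compl_union, mem_inter_iff] at hz
  obtain ⟨hzOut, hzLast, hzBad⟩ := hz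
  have hzS : ∀ i, z i ∈ S := fun i => by
    by_contra h
    exact hzOut (mem_iUnion.mpr ⟨i, h⟩)
  refine ⟨hzS, fun θ hθ => ?_⟩
  -- Each level approximates `θ` directly; consecutive approximants are compared through `θ`, whence
  -- the radius 4 instead of 2.
  choose b hbT hb using fun k => hTnet k θ hθ
  have hbF : ∀ k, b k ∈ F := fun k => hTF k _ (hbT k)
  have hb0 : b 0 = θ₀ := by simpa [hT0] using hbT 0
  let g : Θ → ℝ := fun θ => deviation P z (fun x => Real.log (f θ x))
  have hstep : ∀ k < m, g (b (k + 1)) - g (b k) ≤ ε k := by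
    intro k hk
    by_contra hcon
    refine hzBad (mem_iUnion₂.mpr ⟨k, Finset.mem_range.mpr hk,
      mem_iUnion₂.mpr ⟨b (k + 1), hbT _, mem_iUnion₂.mpr ⟨b k, hbT _, fun x hx => ?_, ?_⟩⟩⟩)
    · refine abs_log_sub_log_le_envelope hp (hV x) (hfb _ (hbF _) x hx).1 (hfb _ (hbF _) x hx).2
        (hfb _ (hbF _) x hx).1 (hfb _ (hbF _) x hx).2 fun hk0 => ?_
      have h1 := hb (k + 1) (by omega) x hx
      have h2 := hb k hk0 x hx
      rw [abs_sub_comm] at h1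
      have h3 : (1 / 2 : ℝ) ^ (p * (k + 1)) ≤ (1 / 2) ^ (p * k) :=
        pow_le_pow_of_le_one (by norm_num) (by norm_num) (by gcongr; omega)
      have h4 := abs_sub_le (f (b (k + 1)) x) (f θ x) (f (b k) x)
      linarith
    · rw [deviation_sub (hli _ (hbF _)) (hli _ (hbF _))]
      exact not_le.mp hcon
  have hchain : ∀ j ≤ m, g (b j) - g θ₀ ≤ ∑ k ∈ Finset.range j, ε k := by
    intro j
    induction j with
    | zero => intro _; simp [hb0]
    | succ j ih =>
      intro hj
      rw [Finset.sum_range_succ]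
      linarith [ih (by omega), hstep j (by omega)]
  have hlast : g θ - g (b m) ≤ ε m + 2 * ((1 + v) * τ m) := by
    have hrel : ∀ x ∈ S, |Real.log (f θ x) - Real.log (f (b m) x)| ≤ H x := fun x hx => by
      refine abs_log_sub_log_le_envelope hp (hV x) (hfb _ hθ x hx).1 (hfb _ hθ x hx).2
        (hfb _ (hbF _) x hx).1 (hfb _ (hbF _) x hx).2 fun hk0 => ?_
      have h2 := hb m hk0 x hx
      have : (0 : ℝ) < (1 / 2) ^ (p * m) := by positivity
      linarith
    have h1 := deviation_le_of_abs_le (P := P) (z := z)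
      (integrable_of_integrable_sq_mul_exp hHm ha0.le
        (integrable_sq_mul_exp hp hlam hpl (hτ m).le hV hVi hHm hHabs))
      (fun i => hrel (z i) (hzS i)) (by filter_upwards [hae] with x hx using hrel x hx)
    rw [deviation_sub (hli _ hθ) (hli _ (hbF _))] at h1
    have h2 : deviation P z H ≤ ε m := not_lt.mp hzLast
    have h3 := integral_envelope_le hp hlam hpl (hτ m) hVm hV hVi hVQ
    simp only [g]
    linarith
  have hsum : ∑ k ∈ Finset.range (m + 1), ε k ≤
      r * (32 * a * v + 2 * (2 * (2 * p + 1) / a)) := by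
    simp_rw [hε]
    rw [← Finset.mul_sum]
    exact mul_le_mul_of_nonneg_left
      (sum_chain_le _ _ (by positivity) (by positivity) _) hr0.le
  rw [Finset.sum_range_succ] at hsum
  have hτm : (1 + v) * τ m ≤ (1 + v) * (8 * r) :=
    mul_le_mul_of_nonneg_left (by simp only [τ]; linarith) (by positivity)
  have := hchain m le_rfl
  simp only [g] at this hlast
  linarith

/-! ### Gaussian mixture densities: two-sided bounds and exponential moments -/

/-- At `x`, the parameters are those of a mixture with means in `[-B, B]` and standard deviations
in `[σmin, σmax]`. -/
structure MixParams.IsValidAt {d K : ℕ} (p : MixParams d K) (σmin σmax B : ℝ) (x : Fin d → ℝ) :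
    Prop where
  weight_nonneg : ∀ k, 0 ≤ p.weight k x
  weight_sum : ∑ k, p.weight k x = 1
  mean_bdd : ∀ k, |p.mean k x| ≤ B
  std_mem : ∀ k, p.std k x ∈ Icc σmin σmax

theorem gaussianPDFReal_toNNReal_sq {σ : ℝ} (hσ : 0 < σ) (μ y : ℝ) :
    gaussianPDFReal μ (Real.toNNReal (σ ^ 2)) y =
      (√(2 * Real.pi) * σ)⁻¹ * Real.exp (-(y - μ) ^ 2 / (2 * σ ^ 2)) := by
  rw [gaussianPDFReal, Real.coe_toNNReal _ (sq_nonneg σ), Real.sqrt_mul (by positivity),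
    Real.sqrt_sq hσ.le]

theorem toNNReal_sq_ne_zero {σ : ℝ} (hσ : 0 < σ) : Real.toNNReal (σ ^ 2) ≠ 0 := by
  simpa using hσ.ne'

section Bounds

variable {σmin σmax B σ μ : ℝ}

theorem exp_neg_le_gaussianPDFReal (h0 : 0 < σmin) (hσ : σ ∈ Icc σmin σmax) (hμ : |μ| ≤ B) {a : ℝ}
    (ha : |Real.log (√(2 * Real.pi) * σmax)| + (B ^ 2 + 1) / σmin ^ 2 ≤ a) (y : ℝ) :
    Real.exp (-(a * (1 + y ^ 2))) ≤ gaussianPDFReal μ (Real.toNNReal (σ ^ 2)) y := by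
  have hσ0 : 0 < σ := h0.trans_le hσ.1
  have hpi : 0 < √(2 * Real.pi) := by positivity
  have hmax : 0 < σmax := hσ0.trans_le hσ.2
  rw [gaussianPDFReal_toNNReal_sq hσ0]
  have h1 : Real.exp (-|Real.log (√(2 * Real.pi) * σmax)|) ≤ (√(2 * Real.pi) * σ)⁻¹ := by
    have : Real.exp (-Real.log (√(2 * Real.pi) * σmax)) = (√(2 * Real.pi) * σmax)⁻¹ := by
      rw [Real.exp_neg, Real.exp_log (by positivity)]
    calc _ ≤ Real.exp (-Real.log (√(2 * Real.pi) * σmax)) :=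
          Real.exp_le_exp.mpr (neg_le_neg (le_abs_self _))
      _ ≤ _ := by
          rw [this]
          have := hσ.2
          gcongr
  have h2 : (y - μ) ^ 2 / (2 * σ ^ 2) ≤ (B ^ 2 + 1) / σmin ^ 2 * (1 + y ^ 2) := by
    have hμ2 : μ ^ 2 ≤ B ^ 2 := by rw [← sq_abs μ]; gcongr
    calc (y - μ) ^ 2 / (2 * σ ^ 2) ≤ (2 * ((B ^ 2 + 1) * (1 + y ^ 2))) / (2 * σmin ^ 2) := by
          have := hσ.1
          gcongr
          nlinarith [sq_nonneg (y + μ), mul_nonneg (sq_nonneg B) (sq_nonneg y)]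
      _ = _ := by field_simp
  calc Real.exp (-(a * (1 + y ^ 2)))
      ≤ Real.exp (-|Real.log (√(2 * Real.pi) * σmax)| + -((y - μ) ^ 2 / (2 * σ ^ 2))) := by
        refine Real.exp_le_exp.mpr ?_
        have h3 := abs_nonneg (Real.log (√(2 * Real.pi) * σmax))
        have h4 := mul_le_mul_of_nonneg_right ha (by positivity : 0 ≤ 1 + y ^ 2)
        nlinarith [mul_nonneg h3 (sq_nonneg y)]
    _ ≤ _ := by
        rw [Real.exp_add, neg_div]
        gcongr

theorem gaussianPDFReal_le_exp (h0 : 0 < σmin) (hσ : σ ∈ Icc σmin σmax) {a : ℝ}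
    (ha : |Real.log (√(2 * Real.pi) * σmin)| ≤ a) (y : ℝ) :
    gaussianPDFReal μ (Real.toNNReal (σ ^ 2)) y ≤ Real.exp (a * (1 + y ^ 2)) := by
  have hσ0 : 0 < σ := h0.trans_le hσ.1
  have hpi : 0 < √(2 * Real.pi) := by positivity
  rw [gaussianPDFReal_toNNReal_sq hσ0]
  calc _ ≤ (√(2 * Real.pi) * σ)⁻¹ * 1 := by
        gcongr
        refine Real.exp_le_one_iff.mpr ?_
        rw [neg_div]
        exact neg_nonpos.mpr (by positivity)
    _ ≤ (√(2 * Real.pi) * σmin)⁻¹ := by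
        rw [mul_one]
        have := hσ.1
        gcongr
    _ = Real.exp (-Real.log (√(2 * Real.pi) * σmin)) := by
        rw [Real.exp_neg, Real.exp_log (by positivity)]
    _ ≤ _ := by
        refine Real.exp_le_exp.mpr ?_
        have h1 := neg_abs_le (Real.log (√(2 * Real.pi) * σmin))
        have h2 := abs_nonneg (Real.log (√(2 * Real.pi) * σmin))
        nlinarith [mul_nonneg (h2.trans ha) (sq_nonneg y)]

/-- From `(y - μ)² ≥ y²/2 - μ²`, the shift by a bounded mean costs a constant factor and half of the
Gaussian decay rate, uniformly in the parameters. -/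
theorem gaussianPDFReal_le_tail (h0 : 0 < σmin) (hσ : σ ∈ Icc σmin σmax) (hμ : |μ| ≤ B) (y : ℝ) :
    gaussianPDFReal μ (Real.toNNReal (σ ^ 2)) y ≤
      (√(2 * Real.pi) * σmin)⁻¹ * Real.exp (B ^ 2 / (2 * σmax ^ 2)) *
        Real.exp (-(1 / (4 * σmax ^ 2)) * y ^ 2) := by
  have hσ0 : 0 < σ := h0.trans_le hσ.1
  have hpi : 0 < √(2 * Real.pi) := by positivity
  have hmax : 0 < σmax := hσ0.trans_le hσ.2
  have hμ2 : μ ^ 2 ≤ B ^ 2 := by rw [← sq_abs μ]; gcongr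
  rw [gaussianPDFReal_toNNReal_sq hσ0, mul_assoc, ← Real.exp_add]
  have h1 := hσ.1
  gcongr
  have h2 : (y - μ) ^ 2 / (2 * σmax ^ 2) ≤ (y - μ) ^ 2 / (2 * σ ^ 2) := by
    have := hσ.2
    gcongr
  rw [neg_div]
  refine (neg_le_neg h2).trans ?_
  rw [← sub_nonneg]
  have : B ^ 2 / (2 * σmax ^ 2) + -(1 / (4 * σmax ^ 2)) * y ^ 2 - -((y - μ) ^ 2 / (2 * σmax ^ 2)) =
      (2 * B ^ 2 - y ^ 2 + 2 * (y - μ) ^ 2) / (4 * σmax ^ 2) := by field_simp; ring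
  rw [this]
  refine div_nonneg ?_ (by positivity)
  nlinarith [sq_nonneg (y - 2 * μ)]

end Bounds

theorem measurable_density_snd {d K : ℕ} (p : MixParams d K) (x : Fin d → ℝ) :
    Measurable (p.density x) := by
  unfold MixParams.density
  exact Finset.measurable_fun_sum _ fun k _ => (measurable_gaussianPDFReal _ _).const_mul _

theorem MixParams.IsValidAt.le_density {d K : ℕ} {p : MixParams d K} {σmin σmax B : ℝ}
    {x : Fin d → ℝ} (hp : p.IsValidAt σmin σmax B x) {y c : ℝ}
    (hc : ∀ μ σ, |μ| ≤ B → σ ∈ Icc σmin σmax → c ≤ gaussianPDFReal μ (Real.toNNReal (σ ^ 2)) y) :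
    c ≤ p.density x y := by
  calc c = ∑ k, p.weight k x * c := by rw [← Finset.sum_mul, hp.weight_sum, one_mul]
    _ ≤ _ := Finset.sum_le_sum fun k _ =>
      mul_le_mul_of_nonneg_left (hc _ _ (hp.mean_bdd k) (hp.std_mem k)) (hp.weight_nonneg k)

theorem MixParams.IsValidAt.density_le {d K : ℕ} {p : MixParams d K} {σmin σmax B : ℝ}
    {x : Fin d → ℝ} (hp : p.IsValidAt σmin σmax B x) {y c : ℝ}
    (hc : ∀ μ σ, |μ| ≤ B → σ ∈ Icc σmin σmax → gaussianPDFReal μ (Real.toNNReal (σ ^ 2)) y ≤ c) :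
    p.density x y ≤ c := by
  calc _ ≤ ∑ k, p.weight k x * c := Finset.sum_le_sum fun k _ =>
        mul_le_mul_of_nonneg_left (hc _ _ (hp.mean_bdd k) (hp.std_mem k)) (hp.weight_nonneg k)
    _ = c := by rw [← Finset.sum_mul, hp.weight_sum, one_mul]

/-- Two-sided bounds for valid mixtures at a point, with an exponential moment of the exponent. -/
def DensityBounds (σmin σmax B a lam Q : ℝ) : Prop :=
  ∀ (d K : ℕ) (p : MixParams d K) (x : Fin d → ℝ), p.IsValidAt σmin σmax B x →
    (∀ y, Real.exp (-(a * (1 + y ^ 2))) ≤ p.density x y ∧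
      p.density x y ≤ Real.exp (a * (1 + y ^ 2))) ∧
    Integrable (fun y => p.density x y * Real.exp (lam * (a * (1 + y ^ 2)))) ∧
    ∫ y, p.density x y * Real.exp (lam * (a * (1 + y ^ 2))) ≤ Q

theorem exists_density_bounds {σmin σmax : ℝ} (h0 : 0 < σmin) (h1 : σmin < σmax) (B : ℝ) :
    ∃ a lam Q : ℝ, 1 ≤ a ∧ 0 < lam ∧ 0 < Q ∧ DensityBounds σmin σmax B a lam Q := by
  have hmax := h0.trans h1
  set a : ℝ := 1 + |Real.log (√(2 * Real.pi) * σmin)| +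
    (|Real.log (√(2 * Real.pi) * σmax)| + (B ^ 2 + 1) / σmin ^ 2) with ha
  have hpi : 0 < √(2 * Real.pi) := by positivity
  have ha1 : 1 ≤ a := by
    have : 0 ≤ |Real.log (√(2 * Real.pi) * σmin)| +
      (|Real.log (√(2 * Real.pi) * σmax)| + (B ^ 2 + 1) / σmin ^ 2) := by positivity
    linarith
  -- Then `lam * a` is half of the decay rate `1 / (4 σmax²)` of the densities, so a Gaussian factor
  -- remains to integrate.
  set lam : ℝ := 1 / (8 * σmax ^ 2 * a) with hlam
  set c₀ := (√(2 * Real.pi) * σmin)⁻¹ * Real.exp (B ^ 2 / (2 * σmax ^ 2)) with hc₀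
  have hc₀pos : 0 < c₀ := by positivity
  have hG : Integrable fun y : ℝ =>
      c₀ * Real.exp (lam * a) * Real.exp (-(1 / (8 * σmax ^ 2)) * y ^ 2) :=
    (integrable_exp_neg_mul_sq (by positivity)).const_mul _
  have hpos : 0 ≤ ∫ y : ℝ, c₀ * Real.exp (lam * a) * Real.exp (-(1 / (8 * σmax ^ 2)) * y ^ 2) :=
    integral_nonneg fun y => by positivity
  refine ⟨a, lam, 1 + ∫ y, c₀ * Real.exp (lam * a) * Real.exp (-(1 / (8 * σmax ^ 2)) * y ^ 2),
    ha1, by positivity, by linarith, fun _ _ p x hp => ?_⟩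
  have hlow : ∀ y, Real.exp (-(a * (1 + y ^ 2))) ≤ p.density x y := fun y =>
    hp.le_density fun μ σ hμ hσ => exp_neg_le_gaussianPDFReal h0 hσ hμ
      (by rw [ha]; linarith [abs_nonneg (Real.log (√(2 * Real.pi) * σmin))]) y
  have hup : ∀ y, p.density x y ≤ Real.exp (a * (1 + y ^ 2)) := fun y =>
    hp.density_le fun μ σ hμ hσ => gaussianPDFReal_le_exp h0 hσ (by
      have : 0 ≤ |Real.log (√(2 * Real.pi) * σmax)| + (B ^ 2 + 1) / σmin ^ 2 := by positivity
      linarith) y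
  have hle : ∀ y, p.density x y * Real.exp (lam * (a * (1 + y ^ 2))) ≤
      c₀ * Real.exp (lam * a) * Real.exp (-(1 / (8 * σmax ^ 2)) * y ^ 2) := fun y => by
    have htail : p.density x y ≤ c₀ * Real.exp (-(1 / (4 * σmax ^ 2)) * y ^ 2) :=
      hp.density_le fun μ σ hμ hσ => gaussianPDFReal_le_tail h0 hσ hμ y
    calc _ ≤ c₀ * Real.exp (-(1 / (4 * σmax ^ 2)) * y ^ 2) *
          Real.exp (lam * (a * (1 + y ^ 2))) := by gcongr
      _ = _ := by
        rw [mul_assoc c₀, mul_assoc c₀, ← Real.exp_add, ← Real.exp_add]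
        congr 2
        rw [hlam]
        field_simp
        ring
  have hm : Measurable fun y => p.density x y * Real.exp (lam * (a * (1 + y ^ 2))) := by
    have := measurable_density_snd p x
    fun_prop
  have hint : Integrable fun y => p.density x y * Real.exp (lam * (a * (1 + y ^ 2))) :=
    hG.mono' hm.aestronglyMeasurable (Filter.Eventually.of_forall fun y => by
      rw [Real.norm_of_nonneg
        (mul_nonneg ((Real.exp_pos _).le.trans (hlow y)) (Real.exp_pos _).le)]
      exact hle y)
  refine ⟨fun y => ⟨hlow y, hup y⟩, hint, ?_⟩
  linarith [integral_mono hint hG hle]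

theorem integrable_density {d K : ℕ} (p : MixParams d K) (x : Fin d → ℝ) :
    Integrable (p.density x) :=
  integrable_finsetSum _ fun _ _ => (integrable_gaussianPDFReal _ _).const_mul _

theorem MixParams.IsValidAt.integral_density {d K : ℕ} {p : MixParams d K} {σmin σmax B : ℝ}
    {x : Fin d → ℝ} (h0 : 0 < σmin) (hp : p.IsValidAt σmin σmax B x) :
    ∫ y, p.density x y = 1 := by
  unfold MixParams.density
  rw [integral_finsetSum _ fun _ _ => (integrable_gaussianPDFReal _ _).const_mul _,
    ← hp.weight_sum]
  refine Finset.sum_congr rfl fun k _ => ?_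
  rw [integral_const_mul, integral_gaussianPDFReal_eq_one _
    (toNNReal_sq_ne_zero (h0.trans_le (hp.std_mem k).1)), mul_one]

/-! ### Kullback-Leibler divergence of close mixtures -/

/-- Kullback-Leibler divergence of two positive probability densities. -/
theorem klDiv_withDensity {f g : ℝ → ℝ} (hf : Measurable f) (hg : Measurable g)
    (hfpos : ∀ y, 0 < f y) (hgpos : ∀ y, 0 < g y) (hfi : Integrable f) (hgi : Integrable g)
    (hf1 : ∫ y, f y = 1) (hg1 : ∫ y, g y = 1)
    (hint : Integrable fun y => f y * (Real.log (f y) - Real.log (g y))) :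
    klDiv (volume.withDensity fun y => ENNReal.ofReal (f y))
        (volume.withDensity fun y => ENNReal.ofReal (g y)) =
      ENNReal.ofReal (∫ y, f y * (Real.log (f y) - Real.log (g y))) := by
  set P : Measure ℝ := volume.withDensity fun y => ENNReal.ofReal (f y) with hP
  set Q : Measure ℝ := volume.withDensity fun y => ENNReal.ofReal (g y) with hQ
  have huniv : ∀ h : ℝ → ℝ, (∀ y, 0 < h y) → Integrable h → ∫ y, h y = 1 →
      (volume.withDensity fun y => ENNReal.ofReal (h y)) univ = 1 := fun h hpos hi h1 => by
    rw [withDensity_apply _ MeasurableSet.univ, setLIntegral_univ,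
      ← ofReal_integral_eq_lintegral_ofReal hi (Filter.Eventually.of_forall fun y => (hpos y).le),
      h1, ENNReal.ofReal_one]
  have hPp : IsProbabilityMeasure P := ⟨huniv f hfpos hfi hf1⟩
  have hQp : IsProbabilityMeasure Q := ⟨huniv g hgpos hgi hg1⟩
  have hr : Measurable fun y => ENNReal.ofReal (f y / g y) := (hf.div hg).ennreal_ofReal
  have hPQ : P = Q.withDensity fun y => ENNReal.ofReal (f y / g y) := by
    rw [hQ, ← withDensity_mul _ hg.ennreal_ofReal hr, hP]
    congr 1
    funext y
    rw [Pi.mul_apply, ← ENNReal.ofReal_mul (hgpos y).le, mul_div_cancel₀ _ (hgpos y).ne']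
  have hac : P ≪ Q := hPQ ▸ withDensity_absolutelyContinuous _ _
  have hllr : llr P Q =ᵐ[P] fun y => Real.log (f y) - Real.log (g y) := by
    have h1 : P.rnDeriv Q =ᵐ[Q] fun y => ENNReal.ofReal (f y / g y) := by
      conv_lhs => rw [hPQ]
      exact Measure.rnDeriv_withDensity Q hr
    filter_upwards [hac.ae_le h1] with y hy
    rw [llr, hy, ENNReal.toReal_ofReal (div_pos (hfpos y) (hgpos y)).le,
      Real.log_div (hfpos y).ne' (hgpos y).ne']
  have hsm : ∀ h : ℝ → ℝ, (fun y => (ENNReal.ofReal (f y)).toReal • h y) = fun y => f y * h y :=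
    fun h => funext fun y => by rw [ENNReal.toReal_ofReal (hfpos y).le, smul_eq_mul]
  have hfin : ∀ᵐ y : ℝ, ENNReal.ofReal (f y) < ∞ :=
    Filter.Eventually.of_forall fun y => ENNReal.ofReal_lt_top
  have hint' : Integrable (fun y => Real.log (f y) - Real.log (g y)) P := by
    rw [hP, integrable_withDensity_iff_integrable_smul' hf.ennreal_ofReal hfin, hsm]
    exact hint
  rw [klDiv_of_ac_of_integrable hac (hint'.congr hllr.symm), integral_congr_ae hllr, hP,
    integral_withDensity_eq_integral_toReal_smul hf.ennreal_ofReal hfin, hsm, ← hP]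
  simp

/-- The log-sum inequality. -/
theorem sum_mul_log_sub_le {ι : Type*} [Fintype ι] [Nonempty ι] {a b : ι → ℝ} (ha : ∀ i, 0 < a i)
    (hb : ∀ i, 0 < b i) :
    (∑ i, a i) * (Real.log (∑ i, a i) - Real.log (∑ i, b i)) ≤
      ∑ i, a i * (Real.log (a i) - Real.log (b i)) := by
  set A := ∑ i, a i with hA
  set C := ∑ i, b i with hC
  have hA0 : 0 < A := Finset.sum_pos (fun i _ => ha i) Finset.univ_nonempty
  have hC0 : 0 < C := Finset.sum_pos (fun i _ => hb i) Finset.univ_nonempty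
  have key : ∀ i, a i - b i * (A / C) + a i * (Real.log A - Real.log C) ≤
      a i * (Real.log (a i) - Real.log (b i)) := fun i => by
    have h1 := Real.log_le_sub_one_of_pos
      (div_pos (mul_pos (hb i) hA0) (mul_pos (ha i) hC0))
    rw [Real.log_div (mul_pos (hb i) hA0).ne' (mul_pos (ha i) hC0).ne',
      Real.log_mul (hb i).ne' hA0.ne', Real.log_mul (ha i).ne' hC0.ne'] at h1
    have h2 := mul_le_mul_of_nonneg_left h1 (ha i).le
    have h3 : a i * (b i * A / (a i * C) - 1) = b i * (A / C) - a i := by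
      have := (ha i).ne'
      field_simp
    rw [h3] at h2
    linarith
  have h := Finset.sum_le_sum fun i (_ : i ∈ Finset.univ) => key i
  rw [Finset.sum_add_distrib, Finset.sum_sub_distrib, ← Finset.sum_mul, ← Finset.sum_mul, ← hA,
    ← hC, mul_div_cancel₀ _ hC0.ne'] at h
  linarith

theorem integrable_sq_sub_gaussianReal (μ c : ℝ) (v : ℝ≥0) :
    Integrable (fun y => (y - c) ^ 2) (gaussianReal μ v) := by
  have h : MemLp (fun y : ℝ => y - c) 2 (gaussianReal μ v) :=
    (memLp_id_gaussianReal' 2 (by simp)).sub (memLp_const c)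
  exact h.integrable_sq

theorem integral_sq_sub_gaussianReal (μ c : ℝ) (v : ℝ≥0) :
    ∫ y, (y - c) ^ 2 ∂(gaussianReal μ v) = v + (μ - c) ^ 2 := by
  have hid : Integrable (fun y : ℝ => y) (gaussianReal μ v) :=
    (memLp_id_gaussianReal' 1 (by simp)).integrable le_rfl
  have hvar : ∫ y, (y - μ) ^ 2 ∂(gaussianReal μ v) = v := by
    have h := variance_fun_id_gaussianReal (μ := μ) (v := v)
    rw [variance_eq_integral (by fun_prop)] at h
    have h2 := integral_id_gaussianReal (μ := μ) (v := v)
    rw [h2] at h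
    exact h
  have h1 : ∀ y : ℝ, (y - c) ^ 2 = (y - μ) ^ 2 + (2 * (μ - c) * (y - μ) + (μ - c) ^ 2) :=
    fun y => by ring
  have hlin : Integrable (fun y : ℝ => 2 * (μ - c) * (y - μ)) (gaussianReal μ v) :=
    (hid.sub (integrable_const μ)).const_mul _
  have hlin' : Integrable (fun y : ℝ => 2 * (μ - c) * (y - μ) + (μ - c) ^ 2) (gaussianReal μ v) :=
    hlin.add (integrable_const _)
  rw [funext h1, integral_add (integrable_sq_sub_gaussianReal μ μ v) hlin',
    integral_add hlin (integrable_const _), hvar, integral_const_mul,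
    integral_sub hid (integrable_const _), integral_id_gaussianReal]
  simp

theorem log_gaussianPDFReal {σ : ℝ} (hσ : 0 < σ) (μ y : ℝ) :
    Real.log (gaussianPDFReal μ (Real.toNNReal (σ ^ 2)) y) =
      -Real.log (√(2 * Real.pi)) - Real.log σ - (y - μ) ^ 2 / (2 * σ ^ 2) := by
  have hpi : 0 < √(2 * Real.pi) := by positivity
  rw [gaussianPDFReal_toNNReal_sq hσ, Real.log_mul (by positivity) (Real.exp_pos _).ne',
    Real.log_inv, Real.log_mul hpi.ne' hσ.ne', Real.log_exp]
  ring

/-- The left side is the divergence of two Gaussians. Bounding the logarithm by `(σ'²/σ² - 1)/2`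
completes `(σ²/σ'² - 1)/2` to `(σ² - σ'²)² / (2σ²σ'²)`: the first-order terms cancel. -/
theorem gaussian_kl_bound {σ σ' μ μ' σmin σmax η : ℝ} (h0 : 0 < σmin) (hσ : σ ∈ Icc σmin σmax)
    (hσ' : σ' ∈ Icc σmin σmax) (hησ : |σ - σ'| ≤ η) (hημ : |μ - μ'| ≤ η) :
    Real.log σ' - Real.log σ - 1 / 2 + (σ ^ 2 + (μ - μ') ^ 2) / (2 * σ' ^ 2) ≤
      (2 * σmax ^ 2 / σmin ^ 4 + 1 / (2 * σmin ^ 2)) * η ^ 2 := by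
  have hs := h0.trans_le hσ.1
  have hs' := h0.trans_le hσ'.1
  have hη0 : 0 ≤ η := (abs_nonneg _).trans hησ
  have hlog : 2 * (Real.log σ' - Real.log σ) ≤ σ' ^ 2 / σ ^ 2 - 1 := by
    have := Real.log_le_sub_one_of_pos (by positivity : 0 < σ' ^ 2 / σ ^ 2)
    rw [Real.log_div (by positivity) (by positivity), Real.log_pow, Real.log_pow] at this
    push_cast at this
    linarith
  have h1 : (μ - μ') ^ 2 / (2 * σ' ^ 2) ≤ η ^ 2 / (2 * σmin ^ 2) := by
    have := hσ'.1
    rw [← sq_abs (μ - μ')]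
    gcongr
  have h2 : (σ ^ 2 - σ' ^ 2) ^ 2 / (σ ^ 2 * σ' ^ 2) ≤ 4 * σmax ^ 2 * η ^ 2 / σmin ^ 4 := by
    have e1 : (σ ^ 2 - σ' ^ 2) ^ 2 = (σ + σ') ^ 2 * |σ - σ'| ^ 2 := by rw [sq_abs]; ring
    have e2 : (σ + σ') ^ 2 ≤ 4 * σmax ^ 2 := by
      have : σ + σ' ≤ 2 * σmax := by linarith [hσ.2, hσ'.2]
      calc (σ + σ') ^ 2 ≤ (2 * σmax) ^ 2 := by gcongr
        _ = _ := by ring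
    have e3 : σmin ^ 4 ≤ σ ^ 2 * σ' ^ 2 := by
      have := hσ.1
      have := hσ'.1
      calc σmin ^ 4 = σmin ^ 2 * σmin ^ 2 := by ring
        _ ≤ _ := by gcongr
    rw [e1]
    gcongr
  have h3 : σ' ^ 2 / σ ^ 2 - 1 + (σ ^ 2 / σ' ^ 2 - 1) = (σ ^ 2 - σ' ^ 2) ^ 2 / (σ ^ 2 * σ' ^ 2) := by
    field_simp
    ring
  have h4 : (σ ^ 2 + (μ - μ') ^ 2) / (2 * σ' ^ 2) =
      σ ^ 2 / σ' ^ 2 / 2 + (μ - μ') ^ 2 / (2 * σ' ^ 2) := by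
    field_simp
  have h5 : (2 * σmax ^ 2 / σmin ^ 4 + 1 / (2 * σmin ^ 2)) * η ^ 2 =
      4 * σmax ^ 2 * η ^ 2 / σmin ^ 4 / 2 + η ^ 2 / (2 * σmin ^ 2) := by
    field_simp
    ring
  rw [h4, h5]
  linarith

theorem integrable_gaussian_mul {σ : ℝ} (hσ : 0 < σ) (μ : ℝ) {h : ℝ → ℝ}
    (hh : Integrable h (gaussianReal μ (Real.toNNReal (σ ^ 2)))) :
    Integrable fun y => gaussianPDFReal μ (Real.toNNReal (σ ^ 2)) y * h y := by
  rw [gaussianReal_of_var_ne_zero _ (toNNReal_sq_ne_zero hσ),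
    integrable_withDensity_iff_integrable_smul' (measurable_gaussianPDF _ _)
      (Filter.Eventually.of_forall fun _ => gaussianPDF_lt_top)] at hh
  simpa [toReal_gaussianPDF] using hh

section GaussianKL

variable {σ σ' μ μ' : ℝ}

theorem log_gaussian_ratio (hσ : 0 < σ) (hσ' : 0 < σ') (y : ℝ) :
    Real.log (gaussianPDFReal μ (Real.toNNReal (σ ^ 2)) y) -
      Real.log (gaussianPDFReal μ' (Real.toNNReal (σ' ^ 2)) y) =
      (Real.log σ' - Real.log σ) + ((2 * σ' ^ 2)⁻¹ * (y - μ') ^ 2 -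
        (2 * σ ^ 2)⁻¹ * (y - μ) ^ 2) := by
  rw [log_gaussianPDFReal hσ, log_gaussianPDFReal hσ']
  ring

theorem integrable_log_gaussian_ratio (hσ : 0 < σ) (hσ' : 0 < σ') :
    Integrable (fun y => Real.log (gaussianPDFReal μ (Real.toNNReal (σ ^ 2)) y) -
      Real.log (gaussianPDFReal μ' (Real.toNNReal (σ' ^ 2)) y))
      (gaussianReal μ (Real.toNNReal (σ ^ 2))) := by
  simp_rw [log_gaussian_ratio hσ hσ']
  exact (integrable_const _).add (((integrable_sq_sub_gaussianReal _ _ _).const_mul _).sub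
    ((integrable_sq_sub_gaussianReal _ _ _).const_mul _))

theorem integral_gaussian_kl (hσ : 0 < σ) (hσ' : 0 < σ') :
    ∫ y, gaussianPDFReal μ (Real.toNNReal (σ ^ 2)) y *
      (Real.log (gaussianPDFReal μ (Real.toNNReal (σ ^ 2)) y) -
        Real.log (gaussianPDFReal μ' (Real.toNNReal (σ' ^ 2)) y)) =
      Real.log σ' - Real.log σ - 1 / 2 + (σ ^ 2 + (μ - μ') ^ 2) / (2 * σ' ^ 2) := by
  have h := integral_gaussianReal_eq_integral_smul (μ := μ) (v := Real.toNNReal (σ ^ 2))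
    (f := fun y => Real.log (gaussianPDFReal μ (Real.toNNReal (σ ^ 2)) y) -
        Real.log (gaussianPDFReal μ' (Real.toNNReal (σ' ^ 2)) y)) (toNNReal_sq_ne_zero hσ)
  simp only [smul_eq_mul] at h
  rw [← h]
  simp_rw [log_gaussian_ratio hσ hσ']
  have hi := fun c : ℝ => integrable_sq_sub_gaussianReal μ c (Real.toNNReal (σ ^ 2))
  have hi' : Integrable (fun y => (2 * σ' ^ 2)⁻¹ * (y - μ') ^ 2 - (2 * σ ^ 2)⁻¹ * (y - μ) ^ 2)
      (gaussianReal μ (Real.toNNReal (σ ^ 2))) := ((hi _).const_mul _).sub ((hi _).const_mul _)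
  rw [integral_add (integrable_const _) hi', integral_sub ((hi _).const_mul _) ((hi _).const_mul _), integral_const_mul, integral_const_mul,
    integral_sq_sub_gaussianReal, integral_sq_sub_gaussianReal,
    Real.coe_toNNReal _ (sq_nonneg σ)]
  simp only [integral_const, probReal_univ, smul_eq_mul, one_mul, sub_self]
  field_simp
  ring

end GaussianKL

/-- The conditional log-likelihood gap of two mixtures at `x`. -/
noncomputable def klAt {d K K' : ℕ} (p : MixParams d K) (q : MixParams d K') (x : Fin d → ℝ) : ℝ :=
  ∫ y, p.density x y * (Real.log (p.density x y) - Real.log (q.density x y))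

/-- The log-sum inequality pairs the components. For the weights, `log t ≤ t - 1` yields `(π - π̃) +
(π - π̃)²/π̃`; the linear parts vanish after summation because both weight vectors sum to one, and
`π̃ ≥ ε` controls the square. Hence each component costs `O(η²)` rather than `O(η)`. -/
theorem klAt_le_of_close {d M : ℕ} {p q : MixParams d M} {σmin σmax B ε η : ℝ} {x : Fin d → ℝ}
    (h0 : 0 < σmin) (hε : 0 < ε) (hp : p.IsValidAt σmin σmax B x)
    (hq : q.IsValidAt σmin σmax B x) (hpε : ∀ k, ε ≤ p.weight k x) (hqε : ∀ k, ε ≤ q.weight k x)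
    (hw : ∀ k, |p.weight k x - q.weight k x| ≤ η) (hm : ∀ k, |p.mean k x - q.mean k x| ≤ η)
    (hs : ∀ k, |p.std k x - q.std k x| ≤ η)
    (hint : Integrable fun y =>
      p.density x y * (Real.log (p.density x y) - Real.log (q.density x y))) :
    klAt p q x ≤ M * ((1 / ε + (2 * σmax ^ 2 / σmin ^ 4 + 1 / (2 * σmin ^ 2))) * η ^ 2) := by
  set c := 2 * σmax ^ 2 / σmin ^ 4 + 1 / (2 * σmin ^ 2) with hc
  have hc0 : 0 ≤ c := by positivity
  have hne : Nonempty (Fin M) := by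
    by_contra h
    rw [not_nonempty_iff] at h
    simpa using hp.weight_sum
  let φ : Fin M → ℝ → ℝ := fun k y =>
    gaussianPDFReal (p.mean k x) (Real.toNNReal (p.std k x ^ 2)) y
  let ψ : Fin M → ℝ → ℝ := fun k y =>
    gaussianPDFReal (q.mean k x) (Real.toNNReal (q.std k x ^ 2)) y
  have hsp : ∀ k, 0 < p.std k x := fun k => h0.trans_le (hp.std_mem k).1
  have hsq : ∀ k, 0 < q.std k x := fun k => h0.trans_le (hq.std_mem k).1
  have hφ : ∀ k y, 0 < φ k y := fun k y => gaussianPDFReal_pos _ _ _ (toNNReal_sq_ne_zero (hsp k))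
  have hψ : ∀ k y, 0 < ψ k y := fun k y => gaussianPDFReal_pos _ _ _ (toNNReal_sq_ne_zero (hsq k))
  have hpw : ∀ k, 0 < p.weight k x := fun k => hε.trans_le (hpε k)
  have hqw : ∀ k, 0 < q.weight k x := fun k => hε.trans_le (hqε k)
  let ω : Fin M → ℝ := fun k => Real.log (p.weight k x) - Real.log (q.weight k x)
  have hle : ∀ y, p.density x y * (Real.log (p.density x y) - Real.log (q.density x y)) ≤
      ∑ k, p.weight k x * (ω k * φ k y + φ k y * (Real.log (φ k y) - Real.log (ψ k y))) := by
    intro y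
    refine (sum_mul_log_sub_le (fun k => mul_pos (hpw k) (hφ k y))
      (fun k => mul_pos (hqw k) (hψ k y))).trans (le_of_eq (Finset.sum_congr rfl fun k _ => ?_))
    rw [Real.log_mul (hpw k).ne' (hφ k y).ne', Real.log_mul (hqw k).ne' (hψ k y).ne']
    simp only [ω]
    ring
  have hi1 : ∀ k, Integrable fun y => ω k * φ k y := fun k =>
    (integrable_gaussianPDFReal _ _).const_mul _
  have hi2 : ∀ k, Integrable fun y => φ k y * (Real.log (φ k y) - Real.log (ψ k y)) := fun k =>
    integrable_gaussian_mul (hsp k) _ (integrable_log_gaussian_ratio (hsp k) (hsq k))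
  have hi3 : ∀ k, Integrable fun y =>
      p.weight k x * (ω k * φ k y + φ k y * (Real.log (φ k y) - Real.log (ψ k y))) := fun k =>
    ((hi1 k).add (hi2 k)).const_mul _
  have hbound : ∀ k, p.weight k x *
      (ω k + ∫ y, φ k y * (Real.log (φ k y) - Real.log (ψ k y))) ≤
      (p.weight k x - q.weight k x) + (1 / ε * η ^ 2 + c * η ^ 2) := by
    intro k
    have h1 : ∫ y, φ k y * (Real.log (φ k y) - Real.log (ψ k y)) ≤ c * η ^ 2 := by
      refine (integral_gaussian_kl (hsp k) (hsq k)).trans_le ?_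
      exact gaussian_kl_bound h0 (hp.std_mem k) (hq.std_mem k) (hs k) (hm k)
    have h2 : ω k ≤ p.weight k x / q.weight k x - 1 := by
      simp only [ω]
      rw [← Real.log_div (hpw k).ne' (hqw k).ne']
      exact Real.log_le_sub_one_of_pos (div_pos (hpw k) (hqw k))
    have h3 : p.weight k x * (p.weight k x / q.weight k x - 1) =
        (p.weight k x - q.weight k x) + |p.weight k x - q.weight k x| ^ 2 / q.weight k x := by
      have := (hqw k).ne'
      rw [sq_abs]
      field_simp
      ring
    have h4 : |p.weight k x - q.weight k x| ^ 2 / q.weight k x ≤ 1 / ε * η ^ 2 := by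
      rw [one_div_mul_eq_div]
      have := hw k
      have := hqε k
      gcongr
    have h5 : p.weight k x ≤ 1 := by
      rw [← hp.weight_sum]
      exact Finset.single_le_sum (f := fun k => p.weight k x) (fun k _ => hp.weight_nonneg k)
        (Finset.mem_univ k)
    have h6 := mul_le_mul_of_nonneg_left h2 (hpw k).le
    have h7 := mul_le_mul_of_nonneg_left h1 (hpw k).le
    have h8 : p.weight k x * (c * η ^ 2) ≤ c * η ^ 2 :=
      mul_le_of_le_one_left (by positivity) h5
    rw [mul_add]
    linarith
  calc klAt p q x
      ≤ ∫ y, ∑ k, p.weight k x * (ω k * φ k y + φ k y * (Real.log (φ k y) - Real.log (ψ k y))) :=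
        integral_mono hint
          (integrable_finsetSum _ fun k _ => hi3 k) hle
    _ = ∑ k, p.weight k x * (ω k + ∫ y, φ k y * (Real.log (φ k y) - Real.log (ψ k y))) := by
        rw [integral_finsetSum _ fun k _ => hi3 k]
        refine Finset.sum_congr rfl fun k _ => ?_
        rw [integral_const_mul, integral_add (hi1 k) (hi2 k), integral_const_mul,
          integral_gaussianPDFReal_eq_one _ (toNNReal_sq_ne_zero (hsp k)), mul_one]
    _ ≤ ∑ k, ((p.weight k x - q.weight k x) + (1 / ε * η ^ 2 + c * η ^ 2)) :=
        Finset.sum_le_sum fun k _ => hbound k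
    _ = _ := by
        rw [Finset.sum_add_distrib, Finset.sum_sub_distrib, hp.weight_sum, hq.weight_sum]
        simp
        ring

/-! ### Divergence at a fixed covariate -/

section AtPoint

variable {d K K' : ℕ} {p : MixParams d K} {q : MixParams d K'} {σmin σmax B a lam Q : ℝ}
  {x : Fin d → ℝ}

theorem DensityBounds.density_pos (hb : DensityBounds σmin σmax B a lam Q)
    (hp : p.IsValidAt σmin σmax B x) (y : ℝ) : 0 < p.density x y :=
  (Real.exp_pos _).trans_le ((hb _ _ p x hp).1 y).1

/-- Both logarithms are at most `V = a (1 + y²)` in absolute value, and `V ≤ exp (lam V) / lam`.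
This integrable majorant serves every pair of valid mixtures. -/
theorem DensityBounds.norm_le (hb : DensityBounds σmin σmax B a lam Q) (hlam : 0 < lam)
    (hp : p.IsValidAt σmin σmax B x) (hq : q.IsValidAt σmin σmax B x) (y : ℝ) :
    ‖p.density x y * (Real.log (p.density x y) - Real.log (q.density x y))‖ ≤
      2 / lam * (p.density x y * Real.exp (lam * (a * (1 + y ^ 2)))) := by
  have h1 := abs_log_le ((hb _ _ p x hp).1 y).1 ((hb _ _ p x hp).1 y).2
  have h2 := abs_log_le ((hb _ _ q x hq).1 y).1 ((hb _ _ q x hq).1 y).2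
  have h3 := abs_sub (Real.log (p.density x y)) (Real.log (q.density x y))
  have h4 := Real.add_one_le_exp (lam * (a * (1 + y ^ 2)))
  have h5 : a * (1 + y ^ 2) ≤ 1 / lam * Real.exp (lam * (a * (1 + y ^ 2))) := by
    rw [one_div_mul_eq_div, le_div_iff₀ hlam]
    linarith
  rw [norm_mul, Real.norm_of_nonneg (hb.density_pos hp y).le, Real.norm_eq_abs]
  calc _ ≤ p.density x y * (2 * (1 / lam * Real.exp (lam * (a * (1 + y ^ 2))))) := by
        refine mul_le_mul_of_nonneg_left ?_ (hb.density_pos hp y).le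
        linarith
    _ = _ := by ring

theorem DensityBounds.integrable_kl (hb : DensityBounds σmin σmax B a lam Q) (hlam : 0 < lam)
    (hp : p.IsValidAt σmin σmax B x) (hq : q.IsValidAt σmin σmax B x) :
    Integrable fun y => p.density x y * (Real.log (p.density x y) - Real.log (q.density x y)) := by
  have h1 := measurable_density_snd p x
  have h2 := measurable_density_snd q x
  exact ((hb _ _ p x hp).2.1.const_mul (2 / lam)).mono'
    (h1.mul (h1.log.sub h2.log)).aestronglyMeasurable
    (Filter.Eventually.of_forall (hb.norm_le hlam hp hq))

/-- A bound independent of the mixtures and their numbers of components; it makes the theorem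
trivial whenever its right side is not small. -/
theorem DensityBounds.klAt_le (hb : DensityBounds σmin σmax B a lam Q) (hlam : 0 < lam)
    (hp : p.IsValidAt σmin σmax B x) (hq : q.IsValidAt σmin σmax B x) :
    klAt p q x ≤ 2 * Q / lam := by
  calc klAt p q x ≤ ∫ y, 2 / lam * (p.density x y * Real.exp (lam * (a * (1 + y ^ 2)))) :=
        integral_mono (hb.integrable_kl hlam hp hq) ((hb _ _ p x hp).2.1.const_mul _) fun y =>
          (le_abs_self _).trans (hb.norm_le hlam hp hq y)
    _ ≤ 2 / lam * Q := by
        rw [integral_const_mul]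
        exact mul_le_mul_of_nonneg_left (hb _ _ p x hp).2.2 (by positivity)
    _ = _ := by ring

/-- Gibbs' inequality; it is what allows passing from the `ℝ≥0∞`-valued `condKL` to a real integral
over `x`. -/
theorem DensityBounds.klAt_nonneg (hb : DensityBounds σmin σmax B a lam Q) (hlam : 0 < lam)
    (h0 : 0 < σmin) (hp : p.IsValidAt σmin σmax B x) (hq : q.IsValidAt σmin σmax B x) :
    0 ≤ klAt p q x := by
  have h : ∫ y, (p.density x y - q.density x y) = 0 := by
    rw [integral_sub (integrable_density p x) (integrable_density q x), hp.integral_density h0,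
      hq.integral_density h0, sub_self]
  rw [← h]
  refine integral_mono ((integrable_density p x).sub (integrable_density q x))
    (hb.integrable_kl hlam hp hq) fun y => ?_
  have hf := hb.density_pos hp y
  have hg := hb.density_pos hq y
  have h1 := mul_le_mul_of_nonneg_left (Real.log_le_sub_one_of_pos (div_pos hg hf)) hf.le
  rw [Real.log_div hg.ne' hf.ne', mul_sub, mul_sub, mul_div_cancel₀ _ hf.ne'] at h1
  simp only [mul_sub]
  linarith

theorem DensityBounds.klDiv_condLaw (hb : DensityBounds σmin σmax B a lam Q) (hlam : 0 < lam)
    (h0 : 0 < σmin) (hp : p.IsValidAt σmin σmax B x) (hq : q.IsValidAt σmin σmax B x) :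
    klDiv (p.condLaw x) (q.condLaw x) = ENNReal.ofReal (klAt p q x) :=
  klDiv_withDensity (measurable_density_snd p x) (measurable_density_snd q x)
    (hb.density_pos hp) (hb.density_pos hq) (integrable_density p x) (integrable_density q x)
    (hp.integral_density h0) (hq.integral_density h0) (hb.integrable_kl hlam hp hq)

end AtPoint

/-! ### The joint law: disintegration and moments -/

theorem ae_prod_mem {d : ℕ} {X : Set (Fin d → ℝ)} {ν : Measure (Fin d → ℝ)} (hν : ν Xᶜ = 0) (hX : MeasurableSet X) :
    ∀ᵐ z ∂(ν.prod (volume : Measure ℝ)), z ∈ X ×ˢ (univ : Set ℝ) := by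
  have hae : ∀ᵐ x ∂ν, x ∈ X := mem_ae_iff.mpr hν
  refine (Measure.ae_prod_iff_ae_ae (hX.prod MeasurableSet.univ)).mpr ?_
  filter_upwards [hae] with x hx
  exact Filter.Eventually.of_forall fun y => ⟨hx, mem_univ _⟩

theorem jointLaw_compl_eq_zero {d K : ℕ} {p : MixParams d K} {X : Set (Fin d → ℝ)}
    {ν : Measure (Fin d → ℝ)} (hν : ν Xᶜ = 0) (hX : MeasurableSet X) :
    p.jointLaw ν (X ×ˢ (univ : Set ℝ))ᶜ = 0 :=
  withDensity_absolutelyContinuous _ _ (mem_ae_iff.mp (ae_prod_mem hν hX))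

section Joint

variable {d K K' : ℕ} {p : MixParams d K} {q : MixParams d K'} {σmin σmax B a lam Q : ℝ}
  {X : Set (Fin d → ℝ)} {ν : Measure (Fin d → ℝ)} [IsProbabilityMeasure ν]

theorem DensityBounds.condKL_le (hb : DensityBounds σmin σmax B a lam Q) (hlam : 0 < lam)
    (h0 : 0 < σmin) (hν : ν Xᶜ = 0) (hp : ∀ x ∈ X, p.IsValidAt σmin σmax B x)
    (hq : ∀ x ∈ X, q.IsValidAt σmin σmax B x) :
    condKL ν p q ≤ ENNReal.ofReal (2 * Q / lam) := by
  have hae : ∀ᵐ x ∂ν, x ∈ X := mem_ae_iff.mpr hν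
  calc condKL ν p q ≤ ∫⁻ _, ENNReal.ofReal (2 * Q / lam) ∂ν := by
        refine lintegral_mono_ae ?_
        filter_upwards [hae] with x hx
        rw [hb.klDiv_condLaw hlam h0 (hp x hx) (hq x hx)]
        exact ENNReal.ofReal_le_ofReal (hb.klAt_le hlam (hp x hx) (hq x hx))
    _ = _ := by simp

/-- The density is jointly measurable. -/
def MixParams.IsMeasurable (p : MixParams d K) : Prop :=
  Measurable fun z : (Fin d → ℝ) × ℝ => p.density z.1 z.2

theorem MixParams.isMeasurable_of_params (hw : ∀ k, Measurable (p.weight k))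
    (hm : ∀ k, Measurable (p.mean k)) (hs : ∀ k, Measurable (p.std k)) : p.IsMeasurable := by
  unfold MixParams.IsMeasurable MixParams.density
  refine Finset.measurable_fun_sum _ fun k _ => ((hw k).comp measurable_fst).mul ?_
  have h : Measurable fun z : (Fin d → ℝ) × ℝ =>
      (p.mean k z.1, Real.toNNReal (p.std k z.1 ^ 2), z.2) :=
    ((hm k).comp measurable_fst).prodMk
      ((((hs k).comp measurable_fst).pow_const 2).real_toNNReal.prodMk measurable_snd)
  exact measurable_uncurry_gaussianPDFReal.comp h

theorem DensityBounds.isProbabilityMeasure_jointLaw (hb : DensityBounds σmin σmax B a lam Q)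
    (h0 : 0 < σmin) (hν : ν Xᶜ = 0) (hp : ∀ x ∈ X, p.IsValidAt σmin σmax B x)
    (hpm : p.IsMeasurable) : IsProbabilityMeasure (p.jointLaw ν) := by
  have hae : ∀ᵐ x ∂ν, x ∈ X := mem_ae_iff.mpr hν
  refine ⟨?_⟩
  rw [MixParams.jointLaw, withDensity_apply _ MeasurableSet.univ, setLIntegral_univ,
    lintegral_prod _ hpm.ennreal_ofReal.aemeasurable]
  have : ∀ᵐ x ∂ν, ∫⁻ y, ENNReal.ofReal (p.density x y) = 1 := by
    filter_upwards [hae] with x hx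
    rw [← ofReal_integral_eq_lintegral_ofReal (integrable_density p x)
      (Filter.Eventually.of_forall fun y => (hb.density_pos (hp x hx) y).le),
      (hp x hx).integral_density h0, ENNReal.ofReal_one]
  rw [lintegral_congr_ae this]
  simp

/-- Disintegration of the joint law, for functions with bounded conditional absolute mean. -/
theorem DensityBounds.integral_jointLaw (hb : DensityBounds σmin σmax B a lam Q)
    (hν : ν Xᶜ = 0) (hX : MeasurableSet X) (hp : ∀ x ∈ X, p.IsValidAt σmin σmax B x)
    (hpm : p.IsMeasurable) {g : (Fin d → ℝ) × ℝ → ℝ} (hg : Measurable g) {c : ℝ}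
    (hgi : ∀ x ∈ X, Integrable fun y => p.density x y * g (x, y))
    (hgc : ∀ x ∈ X, ∫ y, ‖p.density x y * g (x, y)‖ ≤ c) :
    Integrable g (p.jointLaw ν) ∧
      Integrable (fun x => ∫ y, p.density x y * g (x, y)) ν ∧
      ∫ z, g z ∂(p.jointLaw ν) = ∫ x, (∫ y, p.density x y * g (x, y)) ∂ν := by
  have hae : ∀ᵐ x ∂ν, x ∈ X := mem_ae_iff.mpr hν
  have hfin : ∀ᵐ z ∂(ν.prod (volume : Measure ℝ)), ENNReal.ofReal (p.density z.1 z.2) < ∞ :=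
    Filter.Eventually.of_forall fun z => ENNReal.ofReal_lt_top
  have hm : Measurable fun z : (Fin d → ℝ) × ℝ => p.density z.1 z.2 * g z := Measurable.mul hpm hg
  have hi : Integrable (fun z : (Fin d → ℝ) × ℝ => p.density z.1 z.2 * g z) (ν.prod volume) := by
    rw [integrable_prod_iff hm.aestronglyMeasurable]
    refine ⟨by filter_upwards [hae] with x hx using hgi x hx, ?_⟩
    refine (integrable_const c).mono' hm.aestronglyMeasurable.norm.integral_prod_right' ?_
    filter_upwards [hae] with x hx
    rw [Real.norm_of_nonneg (integral_nonneg fun y => norm_nonneg _)]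
    exact hgc x hx
  have hsm : (fun z : (Fin d → ℝ) × ℝ => (ENNReal.ofReal (p.density z.1 z.2)).toReal • g z)
      =ᵐ[ν.prod volume] fun z => p.density z.1 z.2 * g z := by
    filter_upwards [ae_prod_mem hν hX] with z hz
    rw [ENNReal.toReal_ofReal (hb.density_pos (hp z.1 hz.1) z.2).le, smul_eq_mul]
  refine ⟨?_, hi.integral_prod_left, ?_⟩
  · rw [MixParams.jointLaw, integrable_withDensity_iff_integrable_smul'
      (Measurable.ennreal_ofReal hpm) hfin]
    exact hi.congr hsm.symm
  · rw [MixParams.jointLaw, integral_withDensity_eq_integral_toReal_smul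
      (Measurable.ennreal_ofReal hpm) hfin, integral_congr_ae hsm, integral_prod _ hi]

/-- The moment hypothesis of the uniform deviation bound, for `V = a (1 + y²)`. -/
theorem DensityBounds.integral_exp_jointLaw (hb : DensityBounds σmin σmax B a lam Q)
    (hν : ν Xᶜ = 0) (hX : MeasurableSet X) (hp : ∀ x ∈ X, p.IsValidAt σmin σmax B x)
    (hpm : p.IsMeasurable) :
    Integrable (fun z => Real.exp (lam * (a * (1 + z.2 ^ 2)))) (p.jointLaw ν) ∧
      ∫ z, Real.exp (lam * (a * (1 + z.2 ^ 2))) ∂(p.jointLaw ν) ≤ Q := by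
  have hae : ∀ᵐ x ∂ν, x ∈ X := mem_ae_iff.mpr hν
  have hpos : ∀ x ∈ X, ∀ y, 0 ≤ p.density x y * Real.exp (lam * (a * (1 + y ^ 2))) := fun x hx y =>
    mul_nonneg (hb.density_pos (hp x hx) y).le (Real.exp_pos _).le
  obtain ⟨h1, h2, h3⟩ := hb.integral_jointLaw hν hX hp hpm
    (g := fun z => Real.exp (lam * (a * (1 + z.2 ^ 2)))) (by fun_prop) (c := Q)
    (fun x hx => (hb _ _ p x (hp x hx)).2.1) (fun x hx => by
      simp_rw [Real.norm_of_nonneg (hpos x hx _)]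
      exact (hb _ _ p x (hp x hx)).2.2)
  refine ⟨h1, ?_⟩
  rw [h3]
  calc _ ≤ ∫ _, Q ∂ν := by
        refine integral_mono_ae h2 (integrable_const _) ?_
        filter_upwards [hae] with x hx using (hb _ _ p x (hp x hx)).2.2
    _ = Q := by simp

theorem DensityBounds.integral_log_ratio (hb : DensityBounds σmin σmax B a lam Q)
    (hlam : 0 < lam) (hν : ν Xᶜ = 0) (hX : MeasurableSet X)
    (hp : ∀ x ∈ X, p.IsValidAt σmin σmax B x) (hpm : p.IsMeasurable)
    (hq : ∀ x ∈ X, q.IsValidAt σmin σmax B x) (hqm : q.IsMeasurable) :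
    Integrable (fun x => klAt p q x) ν ∧
      ∫ z, (Real.log (p.density z.1 z.2) - Real.log (q.density z.1 z.2)) ∂(p.jointLaw ν) =
        ∫ x, klAt p q x ∂ν := by
  refine (hb.integral_jointLaw hν hX hp hpm
    (g := fun z => Real.log (p.density z.1 z.2) - Real.log (q.density z.1 z.2))
    ((Measurable.log hpm).sub (Measurable.log hqm)) (c := 2 / lam * Q)
    (fun x hx => hb.integrable_kl hlam (hp x hx) (hq x hx)) fun x hx => ?_).2
  calc _ ≤ ∫ y, 2 / lam * (p.density x y * Real.exp (lam * (a * (1 + y ^ 2)))) :=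
        integral_mono (hb.integrable_kl hlam (hp x hx) (hq x hx)).norm
          ((hb _ _ p x (hp x hx)).2.1.const_mul _) fun y => hb.norm_le hlam (hp x hx) (hq x hx) y
    _ ≤ 2 / lam * Q := by
        rw [integral_const_mul]
        exact mul_le_mul_of_nonneg_left (hb _ _ p x (hp x hx)).2.2 (by positivity)

theorem DensityBounds.integrable_log_density (hb : DensityBounds σmin σmax B a lam Q)
    (hlam : 0 < lam) (hν : ν Xᶜ = 0) (hX : MeasurableSet X)
    (hp : ∀ x ∈ X, p.IsValidAt σmin σmax B x) (hpm : p.IsMeasurable)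
    (hq : ∀ x ∈ X, q.IsValidAt σmin σmax B x) (hqm : q.IsMeasurable) :
    Integrable (fun z => Real.log (q.density z.1 z.2)) (p.jointLaw ν) := by
  refine ((hb.integral_exp_jointLaw hν hX hp hpm).1.const_mul lam⁻¹).mono'
    (Measurable.log hqm).aestronglyMeasurable ?_
  have hae : ∀ᵐ z ∂(p.jointLaw ν), z ∈ X ×ˢ (univ : Set ℝ) :=
    mem_ae_iff.mpr (jointLaw_compl_eq_zero hν hX)
  filter_upwards [hae] with z hz
  have h := (hb _ _ q z.1 (hq z.1 hz.1)).1 z.2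
  refine (abs_log_le h.1 h.2).trans ?_
  rw [inv_mul_eq_div, le_div_iff₀ hlam]
  linarith [Real.add_one_le_exp (lam * (a * (1 + z.2 ^ 2)))]

/-- The loss as a mean of log-density differences under the sampling law, so that it can be compared
with the empirical risk. -/
theorem DensityBounds.condKL_eq (hb : DensityBounds σmin σmax B a lam Q)
    (hlam : 0 < lam) (h0 : 0 < σmin) (hν : ν Xᶜ = 0) (hX : MeasurableSet X)
    (hp : ∀ x ∈ X, p.IsValidAt σmin σmax B x) (hpm : p.IsMeasurable)
    (hq : ∀ x ∈ X, q.IsValidAt σmin σmax B x) (hqm : q.IsMeasurable) :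
    condKL ν p q = ENNReal.ofReal (∫ z, (Real.log (p.density z.1 z.2) -
      Real.log (q.density z.1 z.2)) ∂(p.jointLaw ν)) := by
  have hae : ∀ᵐ x ∂ν, x ∈ X := mem_ae_iff.mpr hν
  obtain ⟨h1, h2⟩ := hb.integral_log_ratio hlam hν hX hp hpm hq hqm
  rw [h2, ofReal_integral_eq_lintegral_ofReal h1, condKL]
  · refine lintegral_congr_ae ?_
    filter_upwards [hae] with x hx using hb.klDiv_condLaw hlam h0 (hp x hx) (hq x hx)
  · filter_upwards [hae] with x hx using hb.klAt_nonneg hlam h0 (hp x hx) (hq x hx)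

end Joint

/-! ### Changing the true model outside `X` -/

section Restrict

variable {d K : ℕ} {X : Set (Fin d → ℝ)} {ν : Measure (Fin d → ℝ)}

/-- The parameters set to zero outside `X`. -/
noncomputable def MixParams.restrict (p : MixParams d K) (X : Set (Fin d → ℝ)) : MixParams d K where
  weight k := X.indicator (p.weight k)
  mean k := X.indicator (p.mean k)
  std k := X.indicator (p.std k)

theorem MixParams.restrict_density (p : MixParams d K) {x : Fin d → ℝ} (hx : x ∈ X) :
    (p.restrict X).density x = p.density x := by
  funext y
  simp [MixParams.density, MixParams.restrict, hx]

theorem MixParams.IsValidAt.restrict {p : MixParams d K} {σmin σmax B : ℝ} {x : Fin d → ℝ}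
    (h : p.IsValidAt σmin σmax B x) (hx : x ∈ X) : (p.restrict X).IsValidAt σmin σmax B x := by
  refine ⟨fun k => ?_, ?_, fun k => ?_, fun k => ?_⟩ <;>
    simp only [MixParams.restrict, indicator_of_mem hx]
  · exact h.weight_nonneg k
  · exact h.weight_sum
  · exact h.mean_bdd k
  · exact h.std_mem k

theorem MixParams.restrict_condKL {K' : ℕ} (p : MixParams d K) (q : MixParams d K')
    (hν : ν Xᶜ = 0) : condKL ν (p.restrict X) q = condKL ν p q := by
  have hae : ∀ᵐ x ∂ν, x ∈ X := mem_ae_iff.mpr hν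
  refine lintegral_congr_ae ?_
  filter_upwards [hae] with x hx
  have h : (p.restrict X).condLaw x = p.condLaw x := by
    simp only [MixParams.condLaw, p.restrict_density hx]
  rw [h]

theorem MixParams.restrict_jointLaw [IsProbabilityMeasure ν] (p : MixParams d K) (hν : ν Xᶜ = 0)
    (hX : MeasurableSet X) : (p.restrict X).jointLaw ν = p.jointLaw ν := by
  refine withDensity_congr_ae ?_
  filter_upwards [ae_prod_mem hν hX] with z hz
  rw [p.restrict_density hz.1]

/-- The true parameters are arbitrary, possibly non-measurable, off `X`. Extension by zero repairs
this, and changes neither the joint law nor the loss because `ν` lives on `X`. -/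
theorem MixParams.restrict_isMeasurable {p : MixParams d K} (hX : MeasurableSet X)
    (hw : ∀ k, ContinuousOn (p.weight k) X) (hm : ∀ k, ContinuousOn (p.mean k) X)
    (hs : ∀ k, ContinuousOn (p.std k) X) : (p.restrict X).IsMeasurable := by
  have key : ∀ f : (Fin d → ℝ) → ℝ, ContinuousOn f X → Measurable (X.indicator f) := fun f hf => by
    classical
    exact hf.measurable_piecewise continuousOn_const hX
  exact MixParams.isMeasurable_of_params (fun k => key _ (hw k)) (fun k => key _ (hm k))
    fun k => key _ (hs k)

end Restrict

/-! ### Approximation of the true model within the class -/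

section Weighted

variable {J : Type*} [Fintype J] {φ c : J → ℝ}

theorem le_sum_mul_of_sum_eq_one (hφ : ∀ j, 0 ≤ φ j) (h1 : ∑ j, φ j = 1) {v : ℝ}
    (hc : ∀ j, v ≤ c j) : v ≤ ∑ j, c j * φ j := by
  calc v = ∑ j, v * φ j := by rw [← Finset.mul_sum, h1, mul_one]
    _ ≤ _ := Finset.sum_le_sum fun j _ => mul_le_mul_of_nonneg_right (hc j) (hφ j)

theorem sum_mul_le_of_sum_eq_one (hφ : ∀ j, 0 ≤ φ j) (h1 : ∑ j, φ j = 1) {v : ℝ}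
    (hc : ∀ j, c j ≤ v) : ∑ j, c j * φ j ≤ v := by
  calc _ ≤ ∑ j, v * φ j :=
        Finset.sum_le_sum fun j _ => mul_le_mul_of_nonneg_right (hc j) (hφ j)
    _ = v := by rw [← Finset.mul_sum, h1, mul_one]

theorem abs_sub_sum_mul_le (hφ : ∀ j, 0 ≤ φ j) (h1 : ∑ j, φ j = 1) {v η : ℝ}
    (hc : ∀ j, φ j ≠ 0 → |v - c j| ≤ η) : |v - ∑ j, c j * φ j| ≤ η := by
  calc |v - ∑ j, c j * φ j| = |∑ j, (v - c j) * φ j| := by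
        simp_rw [sub_mul]
        rw [Finset.sum_sub_distrib, ← Finset.mul_sum, h1, mul_one]
    _ ≤ ∑ j, |(v - c j) * φ j| := Finset.abs_sum_le_sum_abs _ _
    _ ≤ ∑ j, η * φ j := Finset.sum_le_sum fun j _ => by
        rw [abs_mul, abs_of_nonneg (hφ j)]
        rcases eq_or_ne (φ j) 0 with h | h
        · simp [h]
        · exact mul_le_mul_of_nonneg_right (hc j h) (hφ j)
    _ = η := by rw [← Finset.mul_sum, h1, mul_one]

end Weighted

theorem IsTrueModel.isValidAt {d M : ℕ} {X : Set (Fin d → ℝ)} {s Λ : ℝ≥0} {ε σmin σmax B : ℝ}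
    {p : MixParams d M} (h : IsTrueModel X s Λ ε σmin σmax B p) (hε : 0 < ε) {x : Fin d → ℝ}
    (hx : x ∈ X) : p.IsValidAt σmin σmax B x :=
  ⟨fun k => hε.le.trans (h.weight_mem k x hx).1, h.weight_sum x hx, fun k => h.mean_bdd k x hx,
    fun k => h.std_mem k x hx⟩

theorem MixParams.IsValidAt.nonempty {d M : ℕ} {p : MixParams d M} {σmin σmax B : ℝ}
    {x : Fin d → ℝ} (h : p.IsValidAt σmin σmax B x) : Nonempty (Fin M) := by
  by_contra hne
  rw [not_nonempty_iff] at hne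
  simpa using h.weight_sum

theorem isValidAt_of_mem_modelClass {d n K : ℕ} {X : Set (Fin d → ℝ)} {σmin σmax B : ℝ} {L : ℕ∞}
    {W : ℝ≥0∞} {p : MixParams d K} (hp : p ∈ modelClass X σmin σmax B n K L W) {x : Fin d → ℝ}
    (hx : x ∈ X) : p.IsValidAt σmin σmax B x :=
  have h := hp.2.2.2 x hx
  ⟨fun k => (h.2 k).1, h.1, fun k => (h.2 k).2.1, fun k => (h.2 k).2.2⟩

theorem isMeasurable_of_mem_modelClass {d n K : ℕ} {X : Set (Fin d → ℝ)} {σmin σmax B : ℝ}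
    {L : ℕ∞} {W : ℝ≥0∞} {p : MixParams d K} (hp : p ∈ modelClass X σmin σmax B n K L W) :
    p.IsMeasurable :=
  MixParams.isMeasurable_of_params (fun k => (hp.1 k).continuous.measurable)
    (fun k => (hp.2.1 k).continuous.measurable) fun k => (hp.2.2.1 k).continuous.measurable

/-- Approximation of the true model, uniformly on `X`, by a mixture in the model class. -/
theorem exists_approx {d M r n q : ℕ} {X : Set (Fin d → ℝ)} {s Λ : ℝ≥0} {ε σmin σmax B D w : ℝ}
    {L : ℕ∞} {W : ℝ≥0∞} {p : MixParams d M} (hp : IsTrueModel X s Λ ε σmin σmax B p) (hε : 0 < ε)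
    (h0 : 0 < σmin) (hX : Bornology.IsBounded X) {x₀ : Fin d → ℝ} (hx₀ : x₀ ∈ X)
    (hD : Metric.diam X ≤ D) (hq : 1 ≤ q) (hW : ENNReal.ofReal w ≤ W) (h3 : 3 ≤ w)
    (hw : (‖x₀‖ + 1) * q + 2 ≤ w) (hBw : B ≤ w) (hσw : σmax ≤ w)
    (hn : (4 * q) ^ d * (2 * (d + 2)) ≤ n) (hL : ((d + 2 : ℕ) : ℕ∞) ≤ L) :
    ∃ f ∈ modelClass X σmin σmax B n (M + r) L W, ∃ g : MixParams d M,
      f.density = g.density ∧ ∀ x ∈ X, g.IsValidAt σmin σmax B x ∧ ∀ k,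
        ε ≤ g.weight k x ∧ |p.weight k x - g.weight k x| ≤ Λ * (2 * ((D + 1) / q)) ^ (s : ℝ) ∧
        |p.mean k x - g.mean k x| ≤ Λ * (2 * ((D + 1) / q)) ^ (s : ℝ) ∧
        |p.std k x - g.std k x| ≤ Λ * (2 * ((D + 1) / q)) ^ (s : ℝ) := by
  obtain ⟨J, _, φ, ξ, hξ, hφ, hφ1, hnear, hnet⟩ := exists_relu_partition hX hx₀ hD hq
  have hval := fun x hx => hp.isValidAt hε (x := x) hx
  obtain ⟨k₀⟩ := (hval x₀ hx₀).nonempty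
  have hB0 : 0 ≤ B := (abs_nonneg _).trans (hp.mean_bdd k₀ x₀ hx₀)
  have hσ0 : 0 < σmax := h0.trans_le ((hp.std_mem k₀ x₀ hx₀).1.trans (hp.std_mem k₀ x₀ hx₀).2)
  have hmin : σmin ≤ σmax := (hp.std_mem k₀ x₀ hx₀).1.trans (hp.std_mem k₀ x₀ hx₀).2
  have hw1 : ∀ k, ∀ x ∈ X, p.weight k x ≤ 1 := fun k x hx => by
    rw [← hp.weight_sum x hx]
    exact Finset.single_le_sum (f := fun k => p.weight k x)
      (fun k _ => (hval x hx).weight_nonneg k) (Finset.mem_univ k)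
  -- One linear operator for all parameters: on `X` its values are averages of samples from `X`, so
  -- bounds persist, and the interpolated weights still sum to one.
  let I : ((Fin d → ℝ) → ℝ) → (Fin d → ℝ) → ℝ := fun u x => ∑ j, u (ξ j) * φ j x
  have hInet : ∀ u : (Fin d → ℝ) → ℝ, (∀ x ∈ X, |u x| ≤ w) → IsReLUNet d n L W (I u) :=
    fun u hu => hnet n W L w hW h3 hw hn hL _ fun j => hu _ (hξ j)
  have hIclose : ∀ u : (Fin d → ℝ) → ℝ, HolderOnWith Λ s u X → ∀ x ∈ X,
      |u x - I u x| ≤ Λ * (2 * ((D + 1) / q)) ^ (s : ℝ) := fun u hu x hx =>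
    abs_sub_sum_mul_le (fun j => hφ j x) (hφ1 x hx) fun j hj =>
      hu.dist_le_of_le hx (hξ j) (hnear x hx j hj)
  let g : MixParams d M := ⟨fun k => I (p.weight k), fun k => I (p.mean k), fun k => I (p.std k)⟩
  have hg : ∀ x ∈ X, g.IsValidAt σmin σmax B x := fun x hx => by
    refine ⟨fun k => ?_, ?_, fun k => abs_le.mpr ⟨?_, ?_⟩, fun k => ⟨?_, ?_⟩⟩
    · exact le_sum_mul_of_sum_eq_one (fun j => hφ j x) (hφ1 x hx)
        fun j => (hval _ (hξ j)).weight_nonneg k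
    · simp only [g, I]
      rw [Finset.sum_comm]
      simp_rw [← Finset.sum_mul, hp.weight_sum _ (hξ _), one_mul]
      exact hφ1 x hx
    · exact le_sum_mul_of_sum_eq_one (fun j => hφ j x) (hφ1 x hx)
        fun j => (abs_le.mp (hp.mean_bdd k _ (hξ j))).1
    · exact sum_mul_le_of_sum_eq_one (fun j => hφ j x) (hφ1 x hx)
        fun j => (abs_le.mp (hp.mean_bdd k _ (hξ j))).2
    · exact le_sum_mul_of_sum_eq_one (fun j => hφ j x) (hφ1 x hx)
        fun j => (hp.std_mem k _ (hξ j)).1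
    · exact sum_mul_le_of_sum_eq_one (fun j => hφ j x) (hφ1 x hx)
        fun j => (hp.std_mem k _ (hξ j)).2
  -- The `r` surplus components have weight zero; `σmax` and mean 0 are merely admissible values.
  let f : MixParams d (M + r) := ⟨Fin.append g.weight fun _ _ => 0, Fin.append g.mean fun _ _ => 0,
    Fin.append g.std fun _ _ => σmax⟩
  refine ⟨f, ⟨fun k => ?_, fun k => ?_, fun k => ?_, fun x hx => ⟨?_, fun k => ?_⟩⟩, g, ?_,
    fun x hx => ⟨hg x hx, fun k => ⟨?_, ?_, ?_, ?_⟩⟩⟩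
  · induction k using Fin.addCases with
    | left k =>
      simp only [f, Fin.append_left]
      refine hInet _ fun x hx => ?_
      rw [abs_of_nonneg ((hval x hx).weight_nonneg k)]
      linarith [hw1 k x hx]
    | right k =>
      simp only [f, Fin.append_right]
      exact isReLUNet_const hW 0 (by simp; linarith)
  · induction k using Fin.addCases with
    | left k =>
      simp only [f, Fin.append_left]
      exact hInet _ fun x hx => (hp.mean_bdd k x hx).trans hBw
    | right k =>
      simp only [f, Fin.append_right]
      exact isReLUNet_const hW 0 (by simp; linarith)
  · induction k using Fin.addCases with
    | left k =>
      simp only [f, Fin.append_left]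
      refine hInet _ fun x hx => ?_
      rw [abs_of_nonneg (h0.le.trans (hp.std_mem k x hx).1)]
      exact (hp.std_mem k x hx).2.trans hσw
    | right k =>
      simp only [f, Fin.append_right]
      exact isReLUNet_const hW σmax (by rwa [abs_of_pos hσ0])
  · rw [Fin.sum_univ_add]
    simp only [f, Fin.append_left, Fin.append_right, Finset.sum_const_zero, add_zero]
    exact (hg x hx).weight_sum
  · induction k using Fin.addCases with
    | left k =>
      simp only [f, Fin.append_left]
      exact ⟨(hg x hx).weight_nonneg k, (hg x hx).mean_bdd k, (hg x hx).std_mem k⟩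
    | right k =>
      simp only [f, Fin.append_right]
      exact ⟨le_rfl, by simpa using hB0, hmin, le_rfl⟩
  · funext x y
    simp only [MixParams.density]
    rw [Fin.sum_univ_add]
    simp only [f, Fin.append_left, Fin.append_right, zero_mul, Finset.sum_const_zero, add_zero]
  · exact le_sum_mul_of_sum_eq_one (fun j => hφ j x) (hφ1 x hx)
      fun j => (hp.weight_mem k _ (hξ j)).1
  · exact hIclose _ (hp.weight_holder k) x hx
  · exact hIclose _ (hp.mean_holder k) x hx
  · exact hIclose _ (hp.std_holder k) x hx

/-! ### Lower bound for the complexity, and the grid size -/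

/-- The model class contains a curve of densities, so its complexity is at least one. -/
theorem one_le_complexity_modelClass {d n K : ℕ} {X : Set (Fin d → ℝ)} {σmin σmax B w : ℝ} {L : ℕ∞}
    {W : ℝ≥0∞} {x₀ : Fin d → ℝ} (hx₀ : x₀ ∈ X) (h0 : 0 < σmin) (h1 : σmin < σmax) (hB : 0 ≤ B)
    (hK : 1 ≤ K) (hW : ENNReal.ofReal w ≤ W) (hw : 1 ≤ w) (hσw : σmax ≤ w) :
    1 ≤ complexity X (modelClass X σmin σmax B n K L W) := by
  have hK0 : (0 : ℝ) < K := by exact_mod_cast hK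
  have hmax := h0.trans h1
  have hpi : 0 < √(2 * Real.pi) := by positivity
  -- All components equal the centred Gaussian of deviation `σ`. Its density at `(x₀, 0)` sweeps an
  -- interval as `σ` varies, and covering an interval takes of the order of `1/η` balls.
  let P : ℝ → MixParams d K := fun σ => ⟨fun _ _ => 1 / K, fun _ _ => 0, fun _ _ => σ⟩
  have hP : ∀ σ ∈ Icc σmin σmax, P σ ∈ modelClass X σmin σmax B n K L W := fun σ hσ => by
    refine ⟨fun k => isReLUNet_const hW (1 / (K : ℝ)) ?_,
      fun k => isReLUNet_const hW 0 ?_, fun k => isReLUNet_const hW σ ?_, fun x _ => ⟨?_, fun k => ⟨?_, ?_, hσ⟩⟩⟩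
    · rw [abs_of_pos (by positivity), div_le_iff₀ hK0]
      have : (1 : ℝ) ≤ K := by exact_mod_cast hK
      nlinarith
    · simp; linarith
    · rw [abs_of_pos (h0.trans_le hσ.1)]
      exact hσ.2.trans hσw
    · simp [P, hK0.ne']
    · positivity
    · simpa [P] using hB
  have hPd : ∀ σ, 0 < σ → (P σ).density x₀ 0 = (√(2 * Real.pi) * σ)⁻¹ := fun σ hσ => by
    simp only [MixParams.density, P, gaussianPDFReal_toNNReal_sq hσ]
    simp [hK0.ne']
  refine le_iInf₂ fun C hC => ?_
  by_contra hlt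
  have hC1 : (C : ℝ) < 1 := by
    rw [not_le] at hlt
    exact_mod_cast hlt
  set u := (√(2 * Real.pi) * σmax)⁻¹ with hu
  set v := (√(2 * Real.pi) * σmin)⁻¹ with hv
  have huv : u < v := by
    rw [hu, hv]
    gcongr
  have hu0 : 0 < u := by positivity
  -- At most `η^(-C)` intervals of length `2η` cover `[u, v]`. If `C < 1`, their total length tends
  -- to 0 with `η`.
  have key : ∀ η ∈ Ioc (0 : ℝ) (1 / 2), v - u ≤ 2 * η ^ (1 - (C : ℝ)) := by
    intro η hη
    obtain ⟨t, htc, ht⟩ := hC η hη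
    have hsub : Icc u v ⊆ ⋃ g ∈ t, Icc (g x₀ 0 - η) (g x₀ 0 + η) := by
      intro a ha
      have ha0 : 0 < a := hu0.trans_le ha.1
      have hσ : (√(2 * Real.pi) * a)⁻¹ ∈ Icc σmin σmax := by
        constructor
        · rw [le_inv_comm₀ h0 (by positivity)]
          have := ha.2
          rw [hv, le_inv_comm₀ ha0 (by positivity)] at this
          rw [le_inv_comm₀ (by positivity) h0]
          rw [mul_inv, inv_mul_eq_div, le_div_iff₀ hpi]
          linarith
        · rw [inv_le_comm₀ (by positivity) hmax]
          have := ha.1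
          rw [hu, inv_le_comm₀ (by positivity) ha0] at this
          rw [inv_le_comm₀ hmax (by positivity), mul_inv, inv_mul_eq_div, div_le_iff₀ hpi]
          linarith
      obtain ⟨g, hg, hgx⟩ := ht _ (hP _ hσ)
      have h := hgx x₀ hx₀ 0
      rw [hPd _ (h0.trans_le hσ.1), mul_inv, inv_inv, inv_mul_cancel_left₀ hpi.ne', abs_le] at h
      exact mem_iUnion₂.mpr ⟨g, hg, by linarith [h.2], by linarith [h.1]⟩
    have hvol : volume (Icc u v) ≤ ENNReal.ofReal (t.card * (2 * η)) := by
      refine ((measure_mono hsub).trans (measure_biUnion_finset_le _ _)).trans (le_of_eq ?_)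
      simp_rw [Real.volume_Icc]
      rw [Finset.sum_congr rfl fun g _ =>
        show ENNReal.ofReal (g x₀ 0 + η - (g x₀ 0 - η)) = ENNReal.ofReal (2 * η) by ring_nf,
        Finset.sum_const, nsmul_eq_mul, ENNReal.ofReal_mul (p := (t.card : ℝ)) (by positivity),
        ENNReal.ofReal_natCast]
    rw [Real.volume_Icc, ENNReal.ofReal_le_ofReal_iff
      (mul_nonneg (by positivity) (by linarith [hη.1]))] at hvol
    calc v - u ≤ t.card * (2 * η) := hvol
      _ ≤ (1 / η) ^ (C : ℝ) * (2 * η) :=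
        mul_le_mul_of_nonneg_right htc (by linarith [hη.1])
      _ = _ := by
        rw [Real.rpow_sub hη.1, Real.rpow_one, one_div, Real.inv_rpow hη.1.le]
        ring
  have hlim : Filter.Tendsto (fun η : ℝ => 2 * η ^ (1 - (C : ℝ))) (nhdsWithin 0 (Ioi 0))
      (nhds 0) := by
    have hc : ContinuousAt (fun η : ℝ => 2 * η ^ (1 - (C : ℝ))) 0 :=
      (Real.continuousAt_rpow_const _ _ (Or.inr (by linarith))).const_mul 2
    have h := hc.tendsto.mono_left (nhdsWithin_le_nhds (s := Ioi 0))
    rwa [Real.zero_rpow (by linarith), mul_zero] at h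
  have hle : v - u ≤ 0 := ge_of_tendsto hlim (by
    filter_upwards [Ioc_mem_nhdsGT (by norm_num : (0 : ℝ) < 1 / 2)] with η hη using key η hη)
  linarith

/-- The grid resolution that a network of width `n` affords. -/
theorem exists_grid_size {d n : ℕ} (hd : 1 ≤ d) (hn : 1 ≤ n)
    (hy : 8 * ((d : ℝ) + 2) ≤ (n : ℝ) ^ (1 / (d : ℝ))) :
    ∃ q : ℕ, 1 ≤ q ∧ (4 * q) ^ d * (2 * (d + 2)) ≤ n ∧ q ≤ n ∧
      1 / (q : ℝ) ≤ 16 * ((d : ℝ) + 2) * ((n : ℝ) ^ (1 / (d : ℝ)))⁻¹ := by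
  set y := (n : ℝ) ^ (1 / (d : ℝ)) with hydef
  have hd0 : (0 : ℝ) < d := by exact_mod_cast hd
  have hy0 : 0 < y := by positivity
  have hyd : y ^ d = n := by
    rw [hydef, ← Real.rpow_natCast, ← Real.rpow_mul (by positivity), one_div_mul_cancel hd0.ne',
      Real.rpow_one]
  -- Then `4q ≤ y / (2(d + 2))`, and since `d ≥ 1` the `d`-th power of the denominator absorbs the
  -- `2(d + 2)` neurons per grid point. From `q ≥ 1`, rounding down loses at most a factor 2.
  set q := ⌊y / (8 * ((d : ℝ) + 2))⌋₊ with hq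
  have hz1 : 1 ≤ y / (8 * ((d : ℝ) + 2)) := by rwa [le_div_iff₀ (by positivity), one_mul]
  have hq1 : 1 ≤ q := Nat.le_floor (by simpa using hz1)
  have hq1' : (1 : ℝ) ≤ q := by exact_mod_cast hq1
  have hqle : (q : ℝ) ≤ y / (8 * ((d : ℝ) + 2)) := Nat.floor_le (by positivity)
  have hqlt : y / (8 * ((d : ℝ) + 2)) < q + 1 := Nat.lt_floor_add_one _
  have hmain : ((4 * q : ℕ) : ℝ) ^ d * (2 * ((d : ℝ) + 2)) ≤ n := by
    have h1 : ((4 * q : ℕ) : ℝ) ≤ y / (2 * ((d : ℝ) + 2)) := by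
      push_cast
      calc 4 * (q : ℝ) ≤ 4 * (y / (8 * ((d : ℝ) + 2))) := by gcongr
        _ = _ := by field_simp; norm_num
    have h2 : 2 * ((d : ℝ) + 2) ≤ (2 * ((d : ℝ) + 2)) ^ d :=
      le_self_pow₀ (by linarith) (by omega)
    calc _ ≤ (y / (2 * ((d : ℝ) + 2))) ^ d * (2 * ((d : ℝ) + 2)) ^ d := by gcongr
      _ = y ^ d := by rw [← mul_pow, div_mul_cancel₀ _ (by positivity)]
      _ = n := hyd
  have hmainN : (4 * q) ^ d * (2 * (d + 2)) ≤ n := by exact_mod_cast hmain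
  refine ⟨q, hq1, hmainN, ?_, ?_⟩
  · refine le_trans ?_ hmainN
    calc q ≤ 4 * q := by omega
      _ ≤ (4 * q) ^ d := Nat.le_self_pow (by omega) _
      _ ≤ _ := Nat.le_mul_of_pos_right _ (by omega)
  · rw [← div_eq_mul_inv, div_le_div_iff₀ (by linarith) hy0]
    rw [div_lt_iff₀ (by positivity)] at hqlt
    nlinarith

/-! ### Oracle inequality for empirical risk minimizers -/

theorem nll_eq_neg_deviation {d K N : ℕ} (P : Measure ((Fin d → ℝ) × ℝ))
    (z : Fin N → (Fin d → ℝ) × ℝ) (p : MixParams d K) :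
    nll z p = -deviation P z (fun x => Real.log (p.density x.1 x.2)) -
      ∫ x, Real.log (p.density x.1 x.2) ∂P := by
  rw [nll, deviation, Finset.sum_neg_distrib]
  ring

/-- Oracle inequality for empirical risk minimizers over the model class. -/
theorem exists_oracle_event {σmin σmax B a lam Q : ℝ} (hb : DensityBounds σmin σmax B a lam Q)
    (h0 : 0 < σmin) (ha : 1 ≤ a) (hlam : 0 < lam) (hQ : 0 < Q) :
    ∃ C : ℝ, 0 < C ∧ ∀ {d M K n N : ℕ} {X : Set (Fin d → ℝ)} {ν : Measure (Fin d → ℝ)}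
      [IsProbabilityMeasure ν] {L : ℕ∞} {W : ℝ≥0∞} {p : MixParams d M} {f : MixParams d K}
      {c δ κ : ℝ}, MeasurableSet X → ν Xᶜ = 0 → (∀ x ∈ X, p.IsValidAt σmin σmax B x) →
      p.IsMeasurable → f ∈ modelClass X σmin σmax B n K L W →
      (∀ x ∈ X, klAt p f x ≤ κ) → 1 ≤ c →
      (∀ η ∈ Ioc (0 : ℝ) (1 / 2),
        HasCover X (modelClass X σmin σmax B n K L W) η ((1 / η) ^ c)) →
      1 ≤ N → 0 < δ → δ < 1 → (c + Real.log (1 / δ)) / N ≤ 1 →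
      ∃ A : Set (Fin N → (Fin d → ℝ) × ℝ), MeasurableSet A ∧
        ENNReal.ofReal (1 - δ) ≤ Measure.pi (fun _ : Fin N => p.jointLaw ν) A ∧
        ∀ z ∈ A, ∀ fhat : MixParams d K, IsERM (modelClass X σmin σmax B n K L W) z fhat →
          condKL ν p fhat ≤ ENNReal.ofReal (κ + C * √((c + Real.log (1 / δ)) / N)) := by
  classical
  obtain ⟨C, hC, hdev⟩ := exists_uniform_deviation_event hlam hQ.le
  refine ⟨C, hC, ?_⟩
  intro d M K n N X ν _ L W p f c δ κ hX hν hp hpm hf hκ hc hcov hN hδ hδ1 ht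
  set F := modelClass X σmin σmax B n K L W with hF
  have hPp := hb.isProbabilityMeasure_jointLaw h0 hν hp hpm
  have hae : ∀ᵐ x ∂ν, x ∈ X := mem_ae_iff.mpr hν
  have hval : ∀ q ∈ F, ∀ x ∈ X, q.IsValidAt σmin σmax B x := fun q hq x hx =>
    isValidAt_of_mem_modelClass hq hx
  have hmeas : ∀ q ∈ F, q.IsMeasurable := fun q hq => isMeasurable_of_mem_modelClass hq
  obtain ⟨hexp1, hexp2⟩ := hb.integral_exp_jointLaw hν hX hp hpm
  -- The chain is rooted at the approximant `f`, since only the difference of deviations between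
  -- `fhat` and `f` enters the basic inequality.
  obtain ⟨A, hA, hAμ, hAz⟩ := hdev (p.jointLaw ν) (fun z => a * (1 + z.2 ^ 2))
    (X ×ˢ (univ : Set ℝ)) F (fun q z => q.density z.1 z.2) f c δ N (by fun_prop)
    (fun z => by nlinarith [sq_nonneg z.2]) hexp1 hexp2 (hX.prod MeasurableSet.univ)
    (jointLaw_compl_eq_zero hν hX) hmeas
    (fun q hq z hz => (hb _ _ q z.1 (hval q hq z.1 hz.1)).1 z.2) hf hc
    (fun η hη => by
      obtain ⟨t, htc, ht⟩ := hcov η hη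
      refine ⟨t.image fun g z => g z.1 z.2, le_trans (by exact_mod_cast Finset.card_image_le) htc,
        fun q hq => ?_⟩
      obtain ⟨g, hg, hgx⟩ := ht q hq
      exact ⟨_, Finset.mem_image_of_mem _ hg, fun z hz => hgx z.1 hz.1 z.2⟩)
    hN hδ hδ1 ht
  refine ⟨A, hA, hAμ, fun z hz fhat hfhat => ?_⟩
  have hip := hb.integrable_log_density hlam hν hX hp hpm hp hpm
  have hi : ∀ q ∈ F, Integrable (fun z => Real.log (q.density z.1 z.2)) (p.jointLaw ν) :=
    fun q hq => hb.integrable_log_density hlam hν hX hp hpm (hval q hq) (hmeas q hq)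
  rw [hb.condKL_eq hlam h0 hν hX hp hpm (hval _ hfhat.1) (hmeas _ hfhat.1)]
  refine ENNReal.ofReal_le_ofReal ?_
  have h1 := (hAz z hz).2 fhat hfhat.1
  have h2 := hfhat.2 f hf
  rw [nll_eq_neg_deviation (p.jointLaw ν), nll_eq_neg_deviation (p.jointLaw ν)] at h2
  have h3 : ∫ z, (Real.log (p.density z.1 z.2) - Real.log (f.density z.1 z.2)) ∂(p.jointLaw ν)
      ≤ κ := by
    obtain ⟨hk1, hk2⟩ := hb.integral_log_ratio hlam hν hX hp hpm (hval f hf) (hmeas f hf)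
    rw [hk2]
    calc _ ≤ ∫ _, κ ∂ν := integral_mono_ae hk1 (integrable_const _) (by
          filter_upwards [hae] with x hx using hκ x hx)
      _ = κ := by simp
  rw [integral_sub hip (hi f hf)] at h3
  rw [integral_sub hip (hi fhat hfhat.1)]
  linarith

theorem klAt_congr {d K K₁ K₂ K₃ : ℕ} {p : MixParams d K} {p' : MixParams d K₁}
    {q : MixParams d K₂} {q' : MixParams d K₃} {x : Fin d → ℝ} (hp : p.density x = p'.density x)
    (hq : q.density x = q'.density x) : klAt p q x = klAt p' q' x := by
  rw [klAt, klAt, hp, hq]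

/-- Comparison of a real square-root rate with the corresponding extended rate. -/
theorem ofReal_mul_sqrt_le {c C b l : ℝ} {k : ℝ≥0∞} {N : ℕ} (hN : 1 ≤ N) (hc : 0 ≤ c) (hcC : c ≤ C)
    (hb : 0 ≤ b) (hl : 0 ≤ l) (hbk : ENNReal.ofReal b ≤ 2 * k) :
    ENNReal.ofReal (c * √((b + l) / N)) ≤
      ENNReal.ofReal (√2 * C) * ((k + ENNReal.ofReal l) / (N : ℝ≥0∞)) ^ (1 / 2 : ℝ) := by
  have hN0 : (0 : ℝ) < N := by exact_mod_cast hN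
  have h1 : ENNReal.ofReal ((b + l) / N) ≤ 2 * ((k + ENNReal.ofReal l) / N) := by
    rw [ENNReal.ofReal_div_of_pos hN0, ENNReal.ofReal_natCast, ENNReal.ofReal_add hb hl,
      ← mul_div_assoc, mul_add]
    gcongr
    rw [two_mul]
    exact le_self_add
  have h2 : ENNReal.ofReal √2 = (2 : ℝ≥0∞) ^ (1 / 2 : ℝ) := by
    rw [Real.sqrt_eq_rpow, ← ENNReal.ofReal_rpow_of_nonneg (by norm_num) (by norm_num)]
    norm_num
  rw [ENNReal.ofReal_mul hc, ENNReal.ofReal_mul (Real.sqrt_nonneg _), h2, Real.sqrt_eq_rpow,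
    ← ENNReal.ofReal_rpow_of_nonneg (by positivity) (by norm_num), mul_comm _ (ENNReal.ofReal C),
    mul_assoc, ← ENNReal.mul_rpow_of_nonneg _ _ (by norm_num : (0 : ℝ) ≤ 1 / 2)]
  gcongr

theorem rpow_neg_two_mul_div (n : ℕ) (s : ℝ) (d : ℕ) :
    (n : ℝ) ^ (-(2 * s / d)) = ((((n : ℝ) ^ (1 / (d : ℝ)))⁻¹) ^ s) ^ 2 := by
  rw [← Real.rpow_neg (by positivity), ← Real.rpow_mul (by positivity), ← Real.rpow_natCast,
    ← Real.rpow_mul (by positivity)]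
  congr 1
  push_cast
  ring

end MDN

/-! ### Assembly and degenerate regimes -/

theorem theorem1 (d : ℕ) (hd : 1 ≤ d) (s : ℝ≥0) (hs : 0 < s) :
    -- a depth that depends only on `d` and `s`
    ∃ L₀ : ℕ,
    ∀ (Λ : ℝ≥0) (ε σmin σmax B D : ℝ), 0 < ε → ε < 1 / 2 → 0 < σmin → σmin < σmax →
    ∃ C₂ C₃ : ℝ, 0 < C₂ ∧ 0 < C₃ ∧
    ∀ X : Set (Fin d → ℝ), IsCompact X → Metric.diam X ≤ D →
    ∃ W₀ : ℝ, 0 < W₀ ∧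
    ∀ (M : ℕ) (fstar : MDN.MixParams d M),
      MDN.IsTrueModel X s Λ ε σmin σmax B fstar →
    ∀ ν : Measure (Fin d → ℝ), IsProbabilityMeasure ν → ν Xᶜ = 0 →
    ∀ (n K N : ℕ) (L : ℕ∞) (W : ℝ≥0∞) (δ : ℝ), 1 ≤ n → M ≤ K → 1 ≤ N →
      (L₀ : ℕ∞) ≤ L → ENNReal.ofReal (W₀ * n) ≤ W → 0 < δ → δ < 1 →
    -- an event of probability at least `1 - δ` for `N` i.i.d. samples `(X_i, Y_i)`
    ∃ A : Set (Fin N → (Fin d → ℝ) × ℝ), MeasurableSet A ∧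
      ENNReal.ofReal (1 - δ) ≤ Measure.pi (fun _ : Fin N => fstar.jointLaw ν) A ∧
      ∀ z ∈ A, ∀ fhat : MDN.MixParams d K,
        MDN.IsERM (MDN.modelClass X σmin σmax B n K L W) z fhat →
        MDN.condKL ν fstar fhat ≤
          ENNReal.ofReal (C₂ * K * (n : ℝ) ^ (-(2 * (s : ℝ) / d))) +
          ENNReal.ofReal C₃ *
            ((MDN.complexity X (MDN.modelClass X σmin σmax B n K L W) +
              ENNReal.ofReal (Real.log (1 / δ))) / (N : ℝ≥0∞)) ^ (1 / 2 : ℝ) := by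
  refine ⟨d + 2, fun Λ ε σmin σmax B D hε _ h0 h1 => ?_⟩
  obtain ⟨a, lam, Q, ha, hlam, hQ, hb⟩ := MDN.exists_density_bounds h0 h1 B
  obtain ⟨C, hC, horacle⟩ := MDN.exists_oracle_event hb h0 ha hlam hQ
  set c₁ : ℝ := 1 / ε + (2 * σmax ^ 2 / σmin ^ 4 + 1 / (2 * σmin ^ 2)) with hc₁
  -- The constants are fixed before `X`, when `D` is not yet known to be nonnegative; hence `|D|`.
  set E : ℝ := Λ * (32 * ((d : ℝ) + 2) * (|D| + 1)) ^ (s : ℝ) with hE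
  set κmax : ℝ := 2 * Q / lam with hκmax
  have hκmax0 : 0 < κmax := by positivity
  have hc₁0 : 0 < c₁ := by positivity
  have hE0 : 0 ≤ E := by positivity
  have hσmax := h0.trans h1
  -- The second summand of `C₂` covers widths too small for a grid. In `C₃`, `κmax` covers the case
  -- where the rate exceeds one, and `√2` the use of an exponent up to twice the complexity.
  refine ⟨c₁ * E ^ 2 + κmax * (8 * ((d : ℝ) + 2)) ^ (2 * (s : ℝ)), √2 * (C + κmax),
    by positivity, by positivity, fun X hXc hXD => ?_⟩
  obtain ⟨R, hR0, hR⟩ := hXc.isBounded.exists_pos_norm_le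
  -- Grid labels are of order `q (‖x₀‖ + 1)` and occur as biases, so the weights depend on the
  -- location of `X` through `R`; `q ≤ n` explains the factor `n`.
  refine ⟨R + 6 + |B| + σmax, by positivity, ?_⟩
  intro M fstar hfstar ν hν hνX n K N L W δ hn hMK hN hL hW hδ hδ1
  have hXm : MeasurableSet X := hXc.isClosed.measurableSet
  obtain ⟨x₀, hx₀⟩ : X.Nonempty := by
    rw [nonempty_iff_ne_empty]
    rintro rfl
    simp at hνX
  have hval : ∀ x ∈ X, fstar.IsValidAt σmin σmax B x := fun x hx => hfstar.isValidAt hε hx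
  have hval' : ∀ x ∈ X, (fstar.restrict X).IsValidAt σmin σmax B x := fun x hx =>
    (hval x hx).restrict hx
  have hmeas' : (fstar.restrict X).IsMeasurable :=
    MDN.MixParams.restrict_isMeasurable hXm (fun k => (hfstar.weight_holder k).continuousOn hs)
      (fun k => (hfstar.mean_holder k).continuousOn hs)
      fun k => (hfstar.std_holder k).continuousOn hs
  obtain ⟨k₀⟩ := (hval x₀ hx₀).nonempty
  have hB0 : 0 ≤ B := (abs_nonneg _).trans (hfstar.mean_bdd k₀ x₀ hx₀)
  have hK1 : 1 ≤ K := (Fin.pos k₀).trans_le hMK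
  have hK1' : (1 : ℝ) ≤ K := by exact_mod_cast hK1
  have hn1 : (1 : ℝ) ≤ n := by exact_mod_cast hn
  have hlog : 0 < Real.log (1 / δ) := Real.log_pos (by rw [lt_div_iff₀ hδ]; linarith)
  set w : ℝ := (R + 6 + |B| + σmax) * n with hw
  have hwle : R + 6 + |B| + σmax ≤ w := le_mul_of_one_le_right (by positivity) hn1
  rw [← fstar.restrict_jointLaw hνX hXm]
  simp_rw [← fstar.restrict_condKL _ hνX]
  set p := fstar.restrict X with hp
  have hPp := hb.isProbabilityMeasure_jointLaw h0 hνX hval' hmeas'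
  set F := MDN.modelClass X σmin σmax B n K L W with hF
  set rate : ℝ := (n : ℝ) ^ (-(2 * (s : ℝ) / d)) with hrate
  have hrate0 : 0 < rate := by positivity
  set y : ℝ := (n : ℝ) ^ (1 / (d : ℝ)) with hy
  have hy0 : 0 < y := by positivity
  have hratey : rate = ((y⁻¹) ^ (s : ℝ)) ^ 2 := MDN.rpow_neg_two_mul_div n s d
  set S : ℝ≥0∞ := ((MDN.complexity X F + ENNReal.ofReal (Real.log (1 / δ))) / (N : ℝ≥0∞)) ^
    (1 / 2 : ℝ) with hS
  -- The divergence never exceeds `κmax` on the class, so the sure event suffices once the right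
  -- side does.
  have trivial_case : ENNReal.ofReal κmax ≤
      ENNReal.ofReal ((c₁ * E ^ 2 + κmax * (8 * ((d : ℝ) + 2)) ^ (2 * (s : ℝ))) * K * rate) +
        ENNReal.ofReal (√2 * (C + κmax)) * S →
      ∃ A : Set (Fin N → (Fin d → ℝ) × ℝ), MeasurableSet A ∧
        ENNReal.ofReal (1 - δ) ≤ Measure.pi (fun _ : Fin N => p.jointLaw ν) A ∧
        ∀ z ∈ A, ∀ fhat : MDN.MixParams d K, MDN.IsERM F z fhat → MDN.condKL ν p fhat ≤
          ENNReal.ofReal ((c₁ * E ^ 2 + κmax * (8 * ((d : ℝ) + 2)) ^ (2 * (s : ℝ))) * K * rate) +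
          ENNReal.ofReal (√2 * (C + κmax)) * S := fun h => by
    refine ⟨univ, MeasurableSet.univ, ?_, fun z _ fhat hfhat =>
      (hb.condKL_le hlam h0 hνX hval' fun x hx =>
        MDN.isValidAt_of_mem_modelClass hfhat.1 hx).trans h⟩
    rw [measure_univ, ENNReal.ofReal_le_one]
    linarith
  by_cases hy8 : 8 * ((d : ℝ) + 2) ≤ y
  swap
  · refine trivial_case (le_add_right (ENNReal.ofReal_le_ofReal ?_))
    have h2 : 1 ≤ (8 * ((d : ℝ) + 2)) ^ (2 * (s : ℝ)) * rate := by
      rw [hratey, mul_comm 2 (s : ℝ), Real.rpow_mul (by positivity), Real.rpow_two, ← mul_pow,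
        ← Real.mul_rpow (by positivity) (by positivity)]
      refine one_le_pow₀ (Real.one_le_rpow ?_ s.2)
      rw [← div_eq_mul_inv, le_div_iff₀ hy0, one_mul]
      exact (not_le.mp hy8).le
    calc κmax ≤ κmax * ((8 * ((d : ℝ) + 2)) ^ (2 * (s : ℝ)) * rate) * K := by
          rw [mul_assoc]
          exact le_mul_of_one_le_right hκmax0.le (one_le_mul_of_one_le_of_one_le h2 hK1')
      _ = κmax * (8 * ((d : ℝ) + 2)) ^ (2 * (s : ℝ)) * K * rate := by ring
      _ ≤ _ := by
        gcongr
        exact le_add_of_nonneg_left (by positivity)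
  have hcomp1 : 1 ≤ MDN.complexity X F :=
    MDN.one_le_complexity_modelClass hx₀ h0 h1 hB0 hK1 hW
      (by linarith [abs_nonneg B]) (by linarith [abs_nonneg B])
  by_cases hcomp : MDN.complexity X F = ∞
  · refine trivial_case (le_of_le_of_eq le_top (Eq.symm ?_))
    have hS' : S = ∞ := by
      rw [hS, hcomp, top_add, ENNReal.top_div_of_ne_top (ENNReal.natCast_ne_top N),
        ENNReal.top_rpow_of_pos (by norm_num)]
    have hpos : ENNReal.ofReal (√2 * (C + κmax)) ≠ 0 := by
      rw [ne_eq, ENNReal.ofReal_eq_zero, not_le]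
      positivity
    rw [hS', ENNReal.mul_top hpos, add_top]
  -- The infimum need not be used as attained: as it is finite and nonzero, some admissible exponent
  -- lies below its double.
  have hlt : MDN.complexity X F < 2 * MDN.complexity X F := by
    rw [two_mul]
    exact ENNReal.lt_add_right hcomp (zero_lt_one.trans_le hcomp1).ne'
  obtain ⟨c, hc⟩ := iInf_lt_iff.mp hlt
  obtain ⟨hcov, hc2⟩ := iInf_lt_iff.mp hc
  have hc1 : (1 : ℝ) ≤ c := by
    have : (1 : ℝ≥0∞) ≤ c := hcomp1.trans (iInf₂_le c hcov)
    exact_mod_cast this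
  have hcle : ENNReal.ofReal (c : ℝ) ≤ 2 * MDN.complexity X F := by
    rw [ENNReal.ofReal_coe_nnreal]
    exact hc2.le
  by_cases ht : ((c : ℝ) + Real.log (1 / δ)) / N ≤ 1
  swap
  · refine trivial_case (le_add_left (le_trans (ENNReal.ofReal_le_ofReal ?_)
      (MDN.ofReal_mul_sqrt_le hN hκmax0.le (by linarith : κmax ≤ C + κmax) c.2 hlog.le hcle)))
    exact le_mul_of_one_le_right hκmax0.le (Real.one_le_sqrt.mpr (not_le.mp ht).le)
  obtain ⟨q, hq1, hqn, hqle, hqinv⟩ := MDN.exists_grid_size hd hn hy8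
  obtain ⟨r, rfl⟩ := Nat.exists_eq_add_of_le hMK
  have hq1' : (1 : ℝ) ≤ q := by exact_mod_cast hq1
  have hqle' : (q : ℝ) ≤ n := by exact_mod_cast hqle
  obtain ⟨f, hf, g, hfg, hg⟩ := MDN.exists_approx (r := r) hfstar hε h0 hXc.isBounded hx₀
    (hXD.trans (le_abs_self D)) hq1 hW (by linarith [abs_nonneg B])
    (by
      have h2 := hR x₀ hx₀
      have h3 : (‖x₀‖ + 1) * q ≤ (R + 1) * n := by gcongr
      have h4 : 0 ≤ (4 + |B| + σmax) * n := by positivity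
      have h5 : w = (R + 1) * n + (4 + |B| + σmax) * n + n := by rw [hw]; ring
      nlinarith [abs_nonneg B])
    (by linarith [le_abs_self B]) (by linarith [abs_nonneg B]) hqn hL
  set η : ℝ := Λ * (2 * ((|D| + 1) / q)) ^ (s : ℝ) with hη
  have hη0 : 0 ≤ η := by positivity
  have hη2 : η ^ 2 ≤ E ^ 2 * rate := by
    rw [hratey, ← mul_pow]
    refine pow_le_pow_left₀ hη0 ?_ 2
    rw [hη, hE, mul_assoc, ← Real.mul_rpow (by positivity) (by positivity)]
    refine mul_le_mul_of_nonneg_left (Real.rpow_le_rpow (by positivity) ?_ s.2) Λ.2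
    calc 2 * ((|D| + 1) / q) = 2 * (|D| + 1) * (1 / q) := by ring
      _ ≤ 2 * (|D| + 1) * (16 * ((d : ℝ) + 2) * y⁻¹) := by gcongr
      _ = _ := by ring
  have hκ : ∀ x ∈ X, MDN.klAt p f x ≤ M * (c₁ * η ^ 2) := fun x hx => by
    rw [MDN.klAt_congr (fstar.restrict_density hx) (congrFun hfg x)]
    obtain ⟨hgv, hgk⟩ := hg x hx
    exact MDN.klAt_le_of_close h0 hε (hval x hx) hgv (fun k => (hfstar.weight_mem k x hx).1)
      (fun k => (hgk k).1) (fun k => (hgk k).2.1) (fun k => (hgk k).2.2.1)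
      (fun k => (hgk k).2.2.2) (hb.integrable_kl hlam (hval x hx) hgv)
  obtain ⟨A, hA, hAμ, hAz⟩ := horacle hXm hνX hval' hmeas' hf hκ hc1 hcov hN hδ hδ1 ht
  refine ⟨A, hA, hAμ, fun z hz fhat hfhat => (hAz z hz fhat hfhat).trans ?_⟩
  rw [ENNReal.ofReal_add (by positivity) (by positivity)]
  refine add_le_add (ENNReal.ofReal_le_ofReal ?_)
    (MDN.ofReal_mul_sqrt_le hN hC.le (by linarith : C ≤ C + κmax) c.2 hlog.le hcle)
  have hMK' : (M : ℝ) ≤ (M + r : ℕ) := by exact_mod_cast hMK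
  calc (M : ℝ) * (c₁ * η ^ 2) ≤ (M + r : ℕ) * (c₁ * (E ^ 2 * rate)) := by gcongr
    _ = c₁ * E ^ 2 * (M + r : ℕ) * rate := by ring
    _ ≤ _ := by
      gcongr
      exact le_add_of_nonneg_right (by positivity)
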